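/- Let $K\subseteq\mathbb{R}^d$ be a Borel set and let $\rho\colon K\to[0,\infty)$ be a measurable function with $0<\int_K\rho(x)\,dx<\infty$. Let $\pi$ be the probability measure $\pi(A)=\int_A\rho(x)\,dx\big/\int_K\rho(x)\,dx$ on $K$. For $t\ge 0$ let $K(t)=\{x\in K:\rho(x)\ge t\}$ be the level set, let $U_t(A)=\mathrm{vol}_d(A\cap K(t))/\mathrm{vol}_d(K(t))$ be the uniform distribution on $K(t)$ (defined when $0<\mathrm{vol}_d(K(t))<\infty$, and taken to be the zero measure otherwise), let $L_{2,t}=L_2(K(t),U_t)$, and let $\ell(t)=\mathrm{vol}_d(K(t))\big/\int_0^\infty\mathrm{vol}_d(K(s))\,ds$ be the probability density of the level. For every $t>0$ let $H_t$ be a Markov transition kernel on $K(t)$, such that $(x,t)\mapsto H_t(x,A)$ is measurable for every Borel set $A\subseteq K$. The hybrid slice sampler $H$ and the simple slice sampler $U$ are the transition kernels $$H(x,A)=\frac1{\rho(x)}\int_0^{\rho(x)}H_t(x,A)\,dt,\qquad U(x,A)=\frac1{\rho(x)}\int_0^{\rho(x)}U_t(A)\,dt$$ for $x\in K$ with $\rho(x)>0$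 (the other points form a $\pi$-null set). A kernel $P$ with invariant measure $\mu$ acts on $L_2(\mu)$ by $Pf(x)=\int f(y)\,P(x,dy)$; in particular $U_t$ acts on $L_{2,t}$ by $U_tf=\int f\,dU_t$. For a kernel $P$ with invariant distribution $\pi$ let $\mathrm{gap}(P)=1-\|P-S\|_{L_2(\pi)\to L_2(\pi)}$, where $Sf=\int f\,d\pi$. Suppose that for $\ell$-almost every $t$ the kernel $H_t$ is reversible with respect to $U_t$ and positive semi-definite on $L_{2,t}$, that is, $\langle H_tf,f\rangle_{L_{2,t}}\ge 0$ for all $f\in L_{2,t}$. Put $$\beta_k=\sup_{x\in K,\ \rho(x)>0}\left(\frac1{\rho(x)}\int_0^{\rho(x)}\|H_t^k-U_t\|_{L_{2,t}\to L_{2,t}}^2\,dt\right)^{1/2},$$ where the operator norm is read as $0$ if $\mathrm{vol}_d(K(t))=0$, and assume that $\lim_{k\to\infty}\beta_k=0$. Then $$\frac{\mathrm{gap}(U)-\beta_k}{k}\le\mathrm{gap}(H)\le\mathrm{gap}(U)\qquad\text{for every integer } k\ge 1 .$$ -/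

import Mathlib

open MeasureTheory ProbabilityTheory Set Filter Topology
open scoped NNReal ENNReal

namespace SliceSampler

section MarkovOperator

variable {X : Type*} [MeasurableSpace X]

/-- `A` is the operator on `L²(μ)` induced by the kernel `κ`: for every representative `f` of an
element of `L²(μ)`, `A f (x) = ∫ f(y) κ(x, dy)` for `μ`-almost every `x`. -/
def IsMarkovOperator (κ : Kernel X X) (μ : Measure X)
    (A : Lp ℝ 2 μ →L[ℝ] Lp ℝ 2 μ) : Prop :=
  ∀ (f : X → ℝ) (hf : MemLp f 2 μ),
    (A (hf.toLp f) : X → ℝ) =ᵐ[μ] fun x => ∫ y, f y ∂(κ x)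

open Classical in
/-- The operator `f ↦ ∫ f(y) κ(·, dy)` on `L²(μ)`. It exists (and is then unique) as soon as
`μ` is invariant under the (sub-)Markov kernel `κ`, see `isMarkovOperator_markovOp`;
the default value `0` is used otherwise. -/
noncomputable def markovOp (κ : Kernel X X) (μ : Measure X) : Lp ℝ 2 μ →L[ℝ] Lp ℝ 2 μ :=
  if h : ∃ A, IsMarkovOperator κ μ A then h.choose else 0

theorem IsMarkovOperator.unique {κ : Kernel X X} {μ : Measure X}
    {A B : Lp ℝ 2 μ →L[ℝ] Lp ℝ 2 μ}
    (hA : IsMarkovOperator κ μ A) (hB : IsMarkovOperator κ μ B) : A = B := by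
  ext1 f
  have h : f = (Lp.memLp f).toLp f := (Lp.toLp_coeFn f (Lp.memLp f)).symm
  rw [h]
  exact Lp.ext ((hA _ _).trans (hB _ _).symm)

theorem IsMarkovOperator.markovOp_eq {κ : Kernel X X} {μ : Measure X}
    {A : Lp ℝ 2 μ →L[ℝ] Lp ℝ 2 μ} (hA : IsMarkovOperator κ μ A) : markovOp κ μ = A := by
  have h : ∃ A, IsMarkovOperator κ μ A := ⟨A, hA⟩
  rw [markovOp, dif_pos h]
  exact h.choose_spec.unique hA

theorem ae_ae_of_invariant {κ : Kernel X X} {μ : Measure X} (hinv : κ.Invariant μ)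
    {p : X → Prop} (hp : ∀ᵐ x ∂μ, p x) : ∀ᵐ x ∂μ, ∀ᵐ y ∂(κ x), p y := by
  refine Measure.ae_ae_of_ae_bind κ.measurable.aemeasurable ?_
  rwa [show μ.bind κ = μ from hinv]

theorem lintegral_lintegral_of_invariant {κ : Kernel X X} {μ : Measure X}
    (hinv : κ.Invariant μ) {g : X → ℝ≥0∞} (hg : AEMeasurable g μ) :
    ∫⁻ x, ∫⁻ y, g y ∂(κ x) ∂μ = ∫⁻ x, g x ∂μ := by
  rw [← Measure.lintegral_bind κ.measurable.aemeasurable,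
    show μ.bind κ = μ from hinv]
  rwa [show μ.bind κ = μ from hinv]

theorem enorm_integral_sq_le {κ : Kernel X X} {f : X → ℝ} {x : X}
    (hx : κ x univ ≤ 1) (hf : AEStronglyMeasurable f (κ x)) :
    ‖∫ y, f y ∂(κ x)‖ₑ ^ (2 : ℝ) ≤ ∫⁻ y, ‖f y‖ₑ ^ (2 : ℝ) ∂(κ x) := by
  have h1 : ‖∫ y, f y ∂(κ x)‖ₑ ≤ eLpNorm f 2 (κ x) := by
    calc ‖∫ y, f y ∂(κ x)‖ₑ ≤ ∫⁻ y, ‖f y‖ₑ ∂(κ x) := enorm_integral_le_lintegral_enorm _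
      _ = eLpNorm f 1 (κ x) := eLpNorm_one_eq_lintegral_enorm.symm
      _ ≤ eLpNorm f 2 (κ x) * κ x univ ^ (1 / (1 : ℝ≥0∞).toReal - 1 / (2 : ℝ≥0∞).toReal) :=
          eLpNorm_le_eLpNorm_mul_rpow_measure_univ (by norm_num) hf
      _ ≤ eLpNorm f 2 (κ x) * 1 := by
          gcongr
          exact ENNReal.rpow_le_one hx (by norm_num)
      _ = eLpNorm f 2 (κ x) := mul_one _
  calc ‖∫ y, f y ∂(κ x)‖ₑ ^ (2 : ℝ) ≤ eLpNorm f 2 (κ x) ^ (2 : ℝ) := by gcongr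
    _ = ∫⁻ y, ‖f y‖ₑ ^ (2 : ℝ) ∂(κ x) := by
        rw [eLpNorm_eq_lintegral_rpow_enorm_toReal (by norm_num) (by norm_num),
          ← ENNReal.rpow_mul]
        simp

theorem ae_memLp_of_invariant {κ : Kernel X X} {μ : Measure X} (hinv : κ.Invariant μ)
    {f : X → ℝ} (hf : MemLp f 2 μ) : ∀ᵐ x ∂μ, MemLp f 2 (κ x) := by
  set g := hf.1.mk f with hg
  have hgm : StronglyMeasurable g := hf.1.stronglyMeasurable_mk
  have hfg : f =ᵐ[μ] g := hf.1.ae_eq_mk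
  have hg2 : MemLp g 2 μ := (memLp_congr_ae hfg).1 hf
  have hfin : ∫⁻ x, ‖g x‖ₑ ^ (2 : ℝ) ∂μ < ∞ := by
    have := lintegral_rpow_enorm_lt_top_of_eLpNorm_lt_top (by norm_num) (by norm_num) hg2.2
    simpa using this
  have hm : Measurable (fun x => ‖g x‖ₑ ^ (2 : ℝ)) := hgm.enorm.pow_const _
  have hae : ∀ᵐ x ∂μ, ∫⁻ y, ‖g y‖ₑ ^ (2 : ℝ) ∂(κ x) < ∞ := by
    refine ae_lt_top hm.lintegral_kernel ?_
    rw [lintegral_lintegral_of_invariant hinv hm.aemeasurable]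
    exact hfin.ne
  filter_upwards [hae, ae_ae_of_invariant hinv hfg] with x hx hx'
  refine (memLp_congr_ae hx').2 ⟨hgm.aestronglyMeasurable, ?_⟩
  rw [eLpNorm_lt_top_iff_lintegral_rpow_enorm_lt_top (by norm_num) (by norm_num)]
  simpa using hx

theorem ae_integrable_of_invariant {κ : Kernel X X} {μ : Measure X}
    (hκ : ∀ᵐ x ∂μ, κ x univ ≤ 1) (hinv : κ.Invariant μ)
    {f : X → ℝ} (hf : MemLp f 2 μ) : ∀ᵐ x ∂μ, Integrable f (κ x) := by
  filter_upwards [hκ, ae_memLp_of_invariant hinv hf] with x hx hfx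
  have : IsFiniteMeasure (κ x) := ⟨hx.trans_lt ENNReal.one_lt_top⟩
  exact hfx.integrable (by norm_num)

theorem integral_ae_eq_of_invariant {κ : Kernel X X} {μ : Measure X} (hinv : κ.Invariant μ)
    {f g : X → ℝ} (hfg : f =ᵐ[μ] g) :
    (fun x => ∫ y, f y ∂(κ x)) =ᵐ[μ] fun x => ∫ y, g y ∂(κ x) := by
  filter_upwards [ae_ae_of_invariant hinv hfg] with x hx
  exact integral_congr_ae hx

theorem eLpNorm_integral_le {κ : Kernel X X} {μ : Measure X}
    (hκ : ∀ᵐ x ∂μ, κ x univ ≤ 1) (hinv : κ.Invariant μ)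
    {f : X → ℝ} (hf : MemLp f 2 μ) :
    eLpNorm (fun x => ∫ y, f y ∂(κ x)) 2 μ ≤ eLpNorm f 2 μ := by
  rw [eLpNorm_eq_lintegral_rpow_enorm_toReal (by norm_num) (by norm_num),
    eLpNorm_eq_lintegral_rpow_enorm_toReal (by norm_num) (by norm_num)]
  refine ENNReal.rpow_le_rpow ?_ (by positivity)
  have h2 : (2 : ℝ≥0∞).toReal = 2 := by norm_num
  rw [h2, ← lintegral_lintegral_of_invariant hinv (hf.1.enorm.pow_const _)]
  refine lintegral_mono_ae ?_
  filter_upwards [hκ, ae_memLp_of_invariant hinv hf] with x hx hfx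
  exact enorm_integral_sq_le hx hfx.1

theorem memLp_integral {κ : Kernel X X} {μ : Measure X}
    (hκ : ∀ᵐ x ∂μ, κ x univ ≤ 1) (hinv : κ.Invariant μ)
    {f : X → ℝ} (hf : MemLp f 2 μ) : MemLp (fun x => ∫ y, f y ∂(κ x)) 2 μ := by
  refine ⟨?_, (eLpNorm_integral_le hκ hinv hf).trans_lt hf.2⟩
  exact ⟨_, hf.1.stronglyMeasurable_mk.integral_kernel,
    integral_ae_eq_of_invariant hinv hf.1.ae_eq_mk⟩

theorem exists_isMarkovOperator {κ : Kernel X X} {μ : Measure X}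
    (hκ : ∀ᵐ x ∂μ, κ x univ ≤ 1) (hinv : κ.Invariant μ) :
    ∃ A, IsMarkovOperator κ μ A := by
  let L : Lp ℝ 2 μ →ₗ[ℝ] Lp ℝ 2 μ :=
    { toFun := fun f => (memLp_integral hκ hinv (Lp.memLp f)).toLp _
      map_add' := by
        intro f g
        rw [← MemLp.toLp_add, MemLp.toLp_eq_toLp_iff]
        filter_upwards [integral_ae_eq_of_invariant hinv (Lp.coeFn_add f g),
          ae_integrable_of_invariant hκ hinv (Lp.memLp f),
          ae_integrable_of_invariant hκ hinv (Lp.memLp g)] with x h1 h2 h3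
        rw [h1]
        simp only [Pi.add_apply]
        exact integral_add h2 h3
      map_smul' := by
        intro c f
        rw [RingHom.id_apply, ← MemLp.toLp_const_smul, MemLp.toLp_eq_toLp_iff]
        filter_upwards [integral_ae_eq_of_invariant hinv (Lp.coeFn_smul c f)] with x h1
        rw [h1]
        simp only [Pi.smul_apply, smul_eq_mul]
        exact integral_const_mul c _ }
  have hL : ∀ f, ‖L f‖ ≤ 1 * ‖f‖ := by
    intro f
    rw [one_mul, Lp.norm_def, Lp.norm_def]
    refine ENNReal.toReal_mono (Lp.eLpNorm_ne_top f) ?_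
    exact (eLpNorm_congr_ae (MemLp.coeFn_toLp (memLp_integral hκ hinv (Lp.memLp f)))).trans_le
      (eLpNorm_integral_le hκ hinv (Lp.memLp f))
  refine ⟨L.mkContinuous 1 hL, fun f hf => ?_⟩
  refine (MemLp.coeFn_toLp (memLp_integral hκ hinv (Lp.memLp (hf.toLp f)))).trans ?_
  exact integral_ae_eq_of_invariant hinv hf.coeFn_toLp

theorem isMarkovOperator_markovOp {κ : Kernel X X} {μ : Measure X}
    (hκ : ∀ᵐ x ∂μ, κ x univ ≤ 1) (hinv : κ.Invariant μ) :
    IsMarkovOperator κ μ (markovOp κ μ) := by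
  have h := exists_isMarkovOperator hκ hinv
  rw [markovOp, dif_pos h]
  exact h.choose_spec

/-- The operator `S f = ∫ f dπ` (a constant function) on `L²(π)`. -/
noncomputable def meanOp (π : Measure X) : Lp ℝ 2 π →L[ℝ] Lp ℝ 2 π :=
  markovOp (Kernel.const X π) π

/-- The (absolute) `L²(π)` spectral gap `1 - ‖P - S‖` of a kernel `P`. -/
noncomputable def gap (P : Kernel X X) (π : Measure X) : ℝ :=
  1 - ‖markovOp P π - meanOp π‖

end MarkovOperator

section Slices

variable {X : Type*} [MeasurableSpace X]

/-- The level set `K(t) = {x | ρ(x) ≥ t}`. -/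
def levelSet (ρ : X → ℝ≥0) (t : ℝ) : Set X := {x | t ≤ ρ x}

/-- The probability measure with density proportional to `ρ` with respect to `vol`. -/
noncomputable def target (vol : Measure X) (ρ : X → ℝ≥0) : Measure X :=
  (∫⁻ x, ρ x ∂vol)⁻¹ • vol.withDensity fun x => (ρ x : ℝ≥0∞)

/-- The uniform distribution `U_t(A) = vol(A ∩ K(t)) / vol(K(t))` on the level set. (It is the
zero measure if `vol(K(t))` is `0` or `∞`.) -/
noncomputable def levelUniform (vol : Measure X) (ρ : X → ℝ≥0) (t : ℝ) : Measure X :=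
  (vol (levelSet ρ t))⁻¹ • vol.restrict (levelSet ρ t)

/-- The distribution of the level on `[0, ∞)`, with Lebesgue density
`ℓ(t) = vol(K(t)) / ∫₀^∞ vol(K(s)) ds`. -/
noncomputable def levelLaw (vol : Measure X) (ρ : X → ℝ≥0) : Measure ℝ :=
  (volume.restrict (Ici 0)).withDensity fun t =>
    vol (levelSet ρ t) / ∫⁻ s in Ici (0 : ℝ), vol (levelSet ρ s)

theorem measurable_levelUniform (vol : Measure X) (ρ : X → ℝ≥0) :
    Measurable (levelUniform vol ρ) := by
  refine Measure.measurable_of_measurable_coe _ fun A hA => ?_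
  have h : ∀ B : Set X, MeasurableSet B → Measurable fun t => vol (B ∩ levelSet ρ t) := by
    intro B _
    refine Antitone.measurable fun s t hst => measure_mono ?_
    exact inter_subset_inter_right _ fun x (hx : t ≤ ρ x) => hst.trans hx
  have h1 : Measurable fun t => vol (levelSet ρ t) := by
    simpa using h univ MeasurableSet.univ
  simp only [levelUniform, Measure.smul_apply, smul_eq_mul, Measure.restrict_apply hA]
  exact h1.inv.mul (h A hA)

/-- The uniform distributions `(x, t) ↦ U_t` on the level sets as a kernel. -/
noncomputable def uniformKernel (vol : Measure X) (ρ : X → ℝ≥0) :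
    Kernel (X × ℝ) X where
  toFun p := levelUniform vol ρ p.2
  measurable' := (measurable_levelUniform vol ρ).comp measurable_snd

/-- `(x, t, A) ↦ H_t(x, A)` is a family of transition kernels `H_t` on the level sets `K(t)`, `t > 0`:
for `x ∈ K(t)`, `H_t(x, ·)` is a probability measure carried by `K(t)`. The values for
`x ∉ K(t)` are irrelevant. -/
def IsSliceFamily (ρ : X → ℝ≥0) (H : Kernel (X × ℝ) X) : Prop :=
  ∀ t : ℝ, 0 < t → ∀ x ∈ levelSet ρ t,
    IsProbabilityMeasure (H (x, t)) ∧ H (x, t) (levelSet ρ t)ᶜ = 0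

/-- The slice sampler `H(x, A) = ρ(x)⁻¹ ∫₀^{ρ(x)} H_t(x, A) dt` determined by the family
`H_t`. (It is the zero measure at the points with `ρ(x) = 0`, which form a `π`-null set.) -/
noncomputable def sliceSampler (ρ : X → ℝ≥0) (hρ : Measurable ρ) (H : Kernel (X × ℝ) X) :
    Kernel X X where
  toFun x := (ρ x : ℝ≥0∞)⁻¹ •
    (volume.restrict (Icc (0 : ℝ) (ρ x))).bind fun t => H (x, t)
  measurable' := by
    refine Measure.measurable_of_measurable_coe _ fun A hA => ?_
    have hb : ∀ x, ((volume.restrict (Icc (0 : ℝ) (ρ x))).bind fun t => H (x, t)) A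
        = ∫⁻ t, {p : X × ℝ | 0 ≤ p.2 ∧ p.2 ≤ ρ p.1}.indicator (fun p => H p A) (x, t) := by
      intro x
      have hm : Measurable fun t : ℝ => H (x, t) := H.measurable.comp measurable_prodMk_left
      rw [Measure.bind_apply hA hm.aemeasurable, ← lintegral_indicator measurableSet_Icc]
      rfl
    simp only [Measure.smul_apply, smul_eq_mul, hb]
    refine hρ.coe_nnreal_ennreal.inv.mul (Measurable.lintegral_prod_right' ?_)
    refine (H.measurable_coe hA).indicator ?_
    exact (measurableSet_le measurable_const measurable_snd).inter
      (measurableSet_le measurable_snd (hρ.comp measurable_fst).coe_nnreal_real)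

theorem sliceSampler_apply {ρ : X → ℝ≥0} (hρ : Measurable ρ) (H : Kernel (X × ℝ) X) (x : X)
    {A : Set X} (hA : MeasurableSet A) :
    sliceSampler ρ hρ H x A = (ρ x : ℝ≥0∞)⁻¹ * ∫⁻ t in Icc (0 : ℝ) (ρ x), H (x, t) A := by
  have hm : Measurable fun t : ℝ => H (x, t) := H.measurable.comp measurable_prodMk_left
  change ((ρ x : ℝ≥0∞)⁻¹ •
    (volume.restrict (Icc (0 : ℝ) (ρ x))).bind fun t => H (x, t)) A = _
  rw [Measure.smul_apply, smul_eq_mul, Measure.bind_apply hA hm.aemeasurable]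

/-- The simple slice sampler `U`, i.e. `H_t = U_t`. -/
noncomputable def simpleSliceSampler (vol : Measure X) (ρ : X → ℝ≥0) (hρ : Measurable ρ) :
    Kernel X X :=
  sliceSampler ρ hρ (uniformKernel vol ρ)

/-- The operator `H_t` on `L_{2,t} = L²(K(t), U_t)`. -/
noncomputable def sliceOp (vol : Measure X) (ρ : X → ℝ≥0) (H : Kernel (X × ℝ) X) (t : ℝ) :
    Lp ℝ 2 (levelUniform vol ρ t) →L[ℝ] Lp ℝ 2 (levelUniform vol ρ t) :=
  markovOp (H.sectL t) (levelUniform vol ρ t)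

/-- `β_k = sup_x (ρ(x)⁻¹ ∫₀^{ρ(x)} ‖H_t^k - U_t‖² dt)^{1/2}`, the norm being the operator norm on
`L_{2,t}` and the supremum running over all `x` with `ρ(x) > 0`. -/
noncomputable def beta (vol : Measure X) (ρ : X → ℝ≥0) (H : Kernel (X × ℝ) X) (k : ℕ) : ℝ≥0∞ :=
  ⨆ (x : X) (_ : 0 < ρ x),
    ((ρ x : ℝ≥0∞)⁻¹ * ∫⁻ t in Icc (0 : ℝ) (ρ x),
      ‖sliceOp vol ρ H t ^ k - meanOp (levelUniform vol ρ t)‖ₑ ^ 2) ^ (1 / 2 : ℝ)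

/-- Lebesgue measure on a subset `K` of `ℝ^d`. -/
noncomputable def lebesgue {d : ℕ} (K : Set (EuclideanSpace ℝ (Fin d))) : Measure K :=
  (volume : Measure (EuclideanSpace ℝ (Fin d))).comap Subtype.val

end Slices

end SliceSampler

/-! Write `π` for the target. Drawing `x` from `π` and then a level uniformly from `[0, ρ(x)]` gives
the same joint law as drawing `t` from `ℓ` and then a point from `U_t`: both are the normalised
volume under the graph of `ρ` (`map_swap_target_compProd`). Hence `⟨Hf, f⟩_π = ∫ ⟨H_t f, f⟩_t ℓ(t)
dt`, and likewise for `U` (`inner_sliceSampler_eq_integral`), so quadratic forms can be compared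
level by level.

On one level, `U_t` is the orthogonal projection onto constants and `H_t` is a positive self-adjoint
operator fixing constants. Therefore `U_t ≤ H_t`, which integrates to `U ≤ H`; both forms being
nonnegative, `‖U - S‖ ≤ ‖H - S‖`, the upper bound.

For the lower bound, Bernoulli's inequality `1 - H_t^k ≤ k (1 - H_t)` (`bernoulli_inner_le`) reduces
matters to the error made when `H_t^k` replaces `U_t`, which is at most `‖H_t^k - U_t‖ ∫ f² dU_t`.
Integrating over `t` and exchanging the order turns this into `∫ f(x)² (ρ(x)⁻¹ ∫₀^{ρ(x)} ‖H_t^k -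
U_t‖ dt) π(dx)`, and Cauchy-Schwarz bounds the inner average by `β_k`
(`integral_levelMoment_sub_le`). The result is `(1 - β_k)‖f‖² - ⟨Uf, f⟩ ≤ k (‖f‖² - ⟨Hf, f⟩)`.
Applied to `f - Sf` it bounds `‖H - S‖` (`div_le_one_sub_norm_sub_proj`), since the norm of a
positive symmetric operator is the supremum of its Rayleigh quotient. -/

namespace SliceSampler

/-! ### Positive symmetric operators and projections onto fixed vectors. -/

section HilbertSpace

variable {E : Type*} [NormedAddCommGroup E] [InnerProductSpace ℝ E] {A M T : E →L[ℝ] E}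

theorem isSymmetric_pow (hA : A.IsSymmetric) (n : ℕ) : (A ^ n : E →L[ℝ] E).IsSymmetric := by
  rw [ContinuousLinearMap.toLinearMap_pow]
  exact LinearMap.IsSymmetric.pow hA n

/-- Moving half of the factors across the inner product leaves `‖A^m f‖²` for even powers and the
form of `A` at `A^m f` for odd ones, so no square root of `A` is needed. -/
theorem inner_pow_self_nonneg (hA : A.IsSymmetric) (hpos : ∀ f, 0 ≤ inner ℝ (A f) f) (n : ℕ)
    (f : E) : 0 ≤ inner ℝ ((A ^ n) f) f := by
  rcases Nat.even_or_odd' n with ⟨m, rfl | rfl⟩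
  · have h : inner ℝ ((A ^ (2 * m)) f) f = inner ℝ ((A ^ m) f) ((A ^ m) f) := by
      rw [two_mul, pow_add, mul_apply_eq_comp]
      exact isSymmetric_pow hA m _ _
    rw [h]
    exact real_inner_self_nonneg
  · have h : inner ℝ ((A ^ (2 * m + 1)) f) f = inner ℝ (A ((A ^ m) f)) ((A ^ m) f) := by
      rw [show 2 * m + 1 = m + (1 + m) by ring, pow_add, pow_add, pow_one,
        mul_apply_eq_comp, mul_apply_eq_comp]
      exact isSymmetric_pow hA m _ _
    rw [h]
    exact hpos _

/-- Bernoulli's inequality for positive operators, `1 + n (A - 1) ≤ A ^ n`, as an inequality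
of quadratic forms. -/
theorem bernoulli_inner_le (hA : A.IsSymmetric) (hpos : ∀ f, 0 ≤ inner ℝ (A f) f) (n : ℕ)
    (f : E) :
    inner ℝ f f - inner ℝ ((A ^ n) f) f ≤ n * (inner ℝ f f - inner ℝ (A f) f) := by
  induction n with
  | zero => simp
  | succ n ih =>
    have hs : ∀ m : ℕ, (A ^ m) f - (A ^ (m + 1)) f = (A ^ m) (f - A f) := by
      intro m
      rw [map_sub, pow_succ, mul_apply_eq_comp]
    -- Telescoping: `f - A^m f` is the sum of `A^j (f - A f)` over `j < m`, and each term pairs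
    -- nonnegatively with `f - A f`. For `m = n` this reads `A^(n+1) ≥ A^n + A - 1`, which is the
    -- induction step.
    have hd : ∀ m : ℕ, 0 ≤ inner ℝ (f - (A ^ m) f) (f - A f) := by
      intro m
      induction m with
      | zero => simp
      | succ m ihm =>
        have h : f - (A ^ (m + 1)) f = (f - (A ^ m) f) + (A ^ m) (f - A f) := by
          rw [← hs m]
          abel
        rw [h, inner_add_left]
        exact add_nonneg ihm (inner_pow_self_nonneg hA hpos m _)
    have hn := hd n
    have h1 : inner ℝ ((A ^ n) f) (A f) = inner ℝ ((A ^ (n + 1)) f) f := by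
      rw [pow_succ', mul_apply_eq_comp]
      exact (hA _ _).symm
    have h2 : inner ℝ f (A f) = inner ℝ (A f) f := real_inner_comm _ _
    rw [inner_sub_left, inner_sub_right, inner_sub_right, h1, h2] at hn
    rw [Nat.cast_succ]
    linarith

/-- `M` is an orthogonal projection that `A` fixes and commutes with, so `A - M = (1 - M) A (1 -
M)`. This transfers positivity from `A` to `A - M`. -/
theorem inner_sub_proj_self (hM : M.IsSymmetric) (hMM : M * M = M) (hAM : A * M = M)
    (hMA : M * A = M) (f : E) :
    inner ℝ ((A - M) f) f = inner ℝ (A (f - M f)) (f - M f) := by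
  have h1 : A (M f) = M f := by rw [← mul_apply_eq_comp, hAM]
  have h2 : M (A f) = M f := by rw [← mul_apply_eq_comp, hMA]
  have h3 : M (M f) = M f := by rw [← mul_apply_eq_comp, hMM]
  have h4 : inner ℝ (A f) (M f) = inner ℝ (M f) f := by
    have := hM (A f) f
    simp only [ContinuousLinearMap.coe_coe] at this
    rw [← this, h2]
  have h5 : inner ℝ (M f) (M f) = inner ℝ (M f) f := by
    have := hM (M f) f
    simp only [ContinuousLinearMap.coe_coe] at this
    rw [← this, h3]
  rw [map_sub, h1, inner_sub_right, sub_apply, inner_sub_left, inner_sub_left,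
    h4, h5]
  ring

theorem norm_sub_proj_apply_le (hM : M.IsSymmetric) (hMM : M * M = M) (f : E) :
    ‖f - M f‖ ≤ ‖f‖ := by
  have h := inner_sub_proj_self (A := 1) hM hMM (one_mul _) (mul_one _) f
  have h3 : M (M f) = M f := by rw [← mul_apply_eq_comp, hMM]
  have h5 : inner ℝ (M f) (M f) = inner ℝ (M f) f := by
    have := hM (M f) f
    simp only [ContinuousLinearMap.coe_coe] at this
    rw [← this, h3]
  simp only [sub_apply, one_apply_eq_self] at h
  rw [inner_sub_left, ← h5, real_inner_self_eq_norm_sq, real_inner_self_eq_norm_sq,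
    real_inner_self_eq_norm_sq] at h
  nlinarith [sq_nonneg ‖M f‖, norm_nonneg f, norm_nonneg (f - M f)]

theorem pow_mul_eq_of_mul_eq (hAM : A * M = M) (n : ℕ) : A ^ n * M = M := by
  induction n with
  | zero => simp
  | succ n ih => rw [pow_succ, mul_assoc, hAM, ih]

theorem mul_pow_eq_of_mul_eq (hMA : M * A = M) (n : ℕ) : M * A ^ n = M := by
  induction n with
  | zero => simp
  | succ n ih => rw [pow_succ, ← mul_assoc, ih, hMA]

theorem inner_pow_sub_proj_nonneg (hA : A.IsSymmetric) (hpos : ∀ f, 0 ≤ inner ℝ (A f) f)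
    (hM : M.IsSymmetric) (hMM : M * M = M) (hAM : A * M = M) (hMA : M * A = M) (n : ℕ) (f : E) :
    0 ≤ inner ℝ ((A ^ n - M) f) f := by
  rw [inner_sub_proj_self hM hMM (pow_mul_eq_of_mul_eq hAM n) (mul_pow_eq_of_mul_eq hMA n)]
  exact inner_pow_self_nonneg hA hpos n _

/-- The norm of a symmetric operator is the supremum of the absolute Rayleigh quotient, and
positivity removes the absolute value. -/
theorem opNorm_le_of_inner_self_le (hT : T.IsSymmetric) (hpos : ∀ f, 0 ≤ inner ℝ (T f) f)
    {c : ℝ} (hc : 0 ≤ c) (hle : ∀ f, inner ℝ (T f) f ≤ c * ‖f‖ ^ 2) : ‖T‖ ≤ c := by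
  rw [ContinuousLinearMap.norm_eq_iSup_rayleighQuotient T hT]
  refine ciSup_le fun f => ?_
  have h : T.rayleighQuotient f = inner ℝ (T f) f / ‖f‖ ^ 2 := rfl
  rw [h, abs_of_nonneg (div_nonneg (hpos f) (by positivity))]
  exact div_le_of_le_mul₀ (by positivity) hc (hle f)

theorem inner_apply_self_le (T : E →L[ℝ] E) (f : E) : inner ℝ (T f) f ≤ ‖T‖ * ‖f‖ ^ 2 := by
  calc inner ℝ (T f) f ≤ ‖T f‖ * ‖f‖ := real_inner_le_norm _ _
    _ ≤ ‖T‖ * ‖f‖ * ‖f‖ := by gcongr; exact T.le_opNorm f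
    _ = ‖T‖ * ‖f‖ ^ 2 := by ring

end HilbertSpace

/-! ### Reversible kernels as symmetric contractions of `L²`. -/

section ReversibleKernel

variable {X Y : Type*} [MeasurableSpace X] [MeasurableSpace Y] {κ : Kernel X X} {μ : Measure X}

theorem invariant_of_isReversible (hκ : ∀ᵐ x ∂μ, κ x univ = 1) (hrev : κ.IsReversible μ) :
    κ.Invariant μ := by
  ext s hs
  rw [Measure.bind_apply hs κ.aemeasurable, ← setLIntegral_univ, hrev MeasurableSet.univ hs,
    setLIntegral_congr_fun_ae hs (g := fun _ => 1) (hκ.mono fun x hx _ => hx)]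
  simp

theorem isReversible_const (μ : Measure X) : (Kernel.const X μ).IsReversible μ := by
  intro A B _ _
  simp [mul_comm]

theorem markovOp_toLp_ae (hκ : ∀ᵐ x ∂μ, κ x univ = 1) (hrev : κ.IsReversible μ)
    {f : X → ℝ} (hf : MemLp f 2 μ) :
    (markovOp κ μ (hf.toLp f) : X → ℝ) =ᵐ[μ] fun x => ∫ y, f y ∂(κ x) :=
  isMarkovOperator_markovOp (hκ.mono fun _ hx => hx.le) (invariant_of_isReversible hκ hrev) f hf

theorem norm_markovOp_le (hκ : ∀ᵐ x ∂μ, κ x univ = 1) (hrev : κ.IsReversible μ) :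
    ‖markovOp κ μ‖ ≤ 1 := by
  refine ContinuousLinearMap.opNorm_le_bound _ zero_le_one fun F => ?_
  rw [one_mul]
  conv_lhs => rw [← Lp.toLp_coeFn F (Lp.memLp F)]
  rw [Lp.norm_def, Lp.norm_def, eLpNorm_congr_ae (markovOp_toLp_ae hκ hrev (Lp.memLp F))]
  exact ENNReal.toReal_mono (Lp.eLpNorm_ne_top F) (eLpNorm_integral_le
    (hκ.mono fun _ hx => hx.le) (invariant_of_isReversible hκ hrev) (Lp.memLp F))

variable [IsFiniteMeasure μ] [IsFiniteKernel κ]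

/-- Detailed balance is exactly exchangeability of one stationary step, tested on rectangles. -/
theorem map_swap_compProd_of_isReversible (hrev : κ.IsReversible μ) :
    (μ ⊗ₘ κ).map Prod.swap = μ ⊗ₘ κ := by
  refine Measure.ext_prod fun hs ht => ?_
  rw [Measure.map_apply measurable_swap (hs.prod ht), preimage_swap_prod,
    Measure.compProd_apply_prod ht hs, Measure.compProd_apply_prod hs ht]
  exact hrev ht hs

theorem map_fst_compProd_of_ae_eq_one {η : Kernel X Y} [IsFiniteKernel η]
    (hη : ∀ᵐ x ∂μ, η x univ = 1) : (μ ⊗ₘ η).map Prod.fst = μ := by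
  ext s hs
  rw [Measure.map_apply measurable_fst hs, ← prod_univ,
    Measure.compProd_apply_prod hs MeasurableSet.univ,
    setLIntegral_congr_fun_ae hs (g := fun _ => 1) (hη.mono fun x hx _ => hx)]
  simp

/-- The start of a stationary step has law `μ` since `κ` has mass one, and the end has law `μ` by
exchangeability; both factors are therefore square-integrable. -/
theorem integrable_mul_compProd (hκ : ∀ᵐ x ∂μ, κ x univ = 1) (hrev : κ.IsReversible μ)
    {f g : X → ℝ} (hf : MemLp f 2 μ) (hg : MemLp g 2 μ) :
    Integrable (fun p : X × X => f p.2 * g p.1) (μ ⊗ₘ κ) := by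
  have h1 : MeasurePreserving Prod.fst (μ ⊗ₘ κ) μ :=
    ⟨measurable_fst, map_fst_compProd_of_ae_eq_one hκ⟩
  have h2 : MeasurePreserving Prod.swap (μ ⊗ₘ κ) (μ ⊗ₘ κ) :=
    ⟨measurable_swap, map_swap_compProd_of_isReversible hrev⟩
  exact (hf.comp_measurePreserving (h1.comp h2)).integrable_mul (hg.comp_measurePreserving h1)

theorem inner_markovOp (hκ : ∀ᵐ x ∂μ, κ x univ = 1) (hrev : κ.IsReversible μ)
    {f g : X → ℝ} (hf : MemLp f 2 μ) (hg : MemLp g 2 μ) :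
    inner ℝ (markovOp κ μ (hf.toLp f)) (hg.toLp g) =
      ∫ p : X × X, f p.2 * g p.1 ∂(μ ⊗ₘ κ) := by
  rw [Measure.integral_compProd (integrable_mul_compProd hκ hrev hf hg), L2.inner_def]
  refine integral_congr_ae ?_
  filter_upwards [markovOp_toLp_ae hκ hrev hf, hg.coeFn_toLp] with x h1 h2
  rw [h1, h2, integral_mul_const]
  simp [mul_comm]

theorem isSymmetric_markovOp (hκ : ∀ᵐ x ∂μ, κ x univ = 1) (hrev : κ.IsReversible μ) :
    (markovOp κ μ).IsSymmetric := by
  intro F G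
  have hF := Lp.toLp_coeFn F (Lp.memLp F)
  have hG := Lp.toLp_coeFn G (Lp.memLp G)
  simp only [ContinuousLinearMap.coe_coe]
  rw [real_inner_comm (markovOp κ μ G) F, ← hF, ← hG, inner_markovOp hκ hrev,
    inner_markovOp hκ hrev]
  conv_rhs => rw [← map_swap_compProd_of_isReversible hrev]
  have hm : MeasurableEmbedding (Prod.swap : X × X → X × X) :=
    MeasurableEquiv.prodComm.measurableEmbedding
  rw [hm.integral_map]
  simp [mul_comm]

end ReversibleKernel

/-! ### The mean as orthogonal projection onto constants. -/

section MeanOperator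

variable {X : Type*} [MeasurableSpace X] {κ : Kernel X X} {μ : Measure X} [IsProbabilityMeasure μ]

theorem ae_const_univ_eq_one (μ : Measure X) [IsProbabilityMeasure μ] :
    ∀ᵐ x ∂μ, Kernel.const X μ x univ = 1 := by
  simp

theorem isSymmetric_meanOp (μ : Measure X) [IsProbabilityMeasure μ] :
    (meanOp μ).IsSymmetric :=
  isSymmetric_markovOp (ae_const_univ_eq_one μ) (isReversible_const μ)

theorem meanOp_apply (F : Lp ℝ 2 μ) :
    meanOp μ F = (memLp_const (∫ x, F x ∂μ)).toLp fun _ => ∫ x, F x ∂μ := by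
  conv_lhs => rw [← Lp.toLp_coeFn F (Lp.memLp F)]
  refine Lp.ext ?_
  exact (markovOp_toLp_ae (ae_const_univ_eq_one μ) (isReversible_const μ) (Lp.memLp F)).trans
    (MemLp.coeFn_toLp _).symm

theorem markovOp_mul_meanOp (hκ : ∀ᵐ x ∂μ, κ x univ = 1) (hrev : κ.IsReversible μ) :
    markovOp κ μ * meanOp μ = meanOp μ := by
  ext1 F
  rw [mul_apply_eq_comp, meanOp_apply]
  refine Lp.ext ?_
  filter_upwards [markovOp_toLp_ae hκ hrev (memLp_const (∫ x, F x ∂μ)), hκ,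
    (memLp_const (μ := μ) (p := 2) (∫ x, F x ∂μ)).coeFn_toLp] with x h1 h2 h3
  rw [h1, h3]
  simp [Measure.real, h2]

theorem meanOp_mul_meanOp (μ : Measure X) [IsProbabilityMeasure μ] :
    meanOp μ * meanOp μ = meanOp μ :=
  markovOp_mul_meanOp (ae_const_univ_eq_one μ) (isReversible_const μ)

/-- Take adjoints in `A * M = M`, written with inner products so that completeness is not required.
-/
theorem mul_eq_of_isSymmetric {E : Type*} [NormedAddCommGroup E] [InnerProductSpace ℝ E]
    {A M : E →L[ℝ] E} (hA : A.IsSymmetric) (hM : M.IsSymmetric) (h : A * M = M) : M * A = M := by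
  ext1 f
  refine ext_inner_right ℝ fun g => ?_
  have h1 : A (M g) = M g := by rw [← mul_apply_eq_comp, h]
  calc inner ℝ (M (A f)) g = inner ℝ (A f) (M g) := hM _ _
    _ = inner ℝ f (A (M g)) := hA _ _
    _ = inner ℝ (M f) g := by rw [h1]; exact (hM f g).symm

theorem meanOp_mul_markovOp [IsFiniteKernel κ] (hκ : ∀ᵐ x ∂μ, κ x univ = 1) (hrev : κ.IsReversible μ) :
    meanOp μ * markovOp κ μ = meanOp μ :=
  mul_eq_of_isSymmetric (isSymmetric_markovOp hκ hrev) (isSymmetric_meanOp μ)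
    (markovOp_mul_meanOp hκ hrev)

end MeanOperator

/-! ### The joint law of point and level, disintegrated in both directions. -/

section Disintegration

variable {X : Type*} [MeasurableSpace X] {vol : Measure X} {ρ : X → ℝ≥0}

theorem measurableSet_levelSet (hρ : Measurable ρ) (t : ℝ) : MeasurableSet (levelSet ρ t) :=
  measurableSet_le measurable_const hρ.coe_nnreal_real

theorem measurable_measure_levelSet (vol : Measure X) (ρ : X → ℝ≥0) :
    Measurable fun t => vol (levelSet ρ t) :=
  Antitone.measurable fun _ _ hst => measure_mono fun _ hx => hst.trans hx

/-- The kernel `x ↦` uniform distribution on `[0, ρ x]`. -/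
noncomputable def levelKernel (ρ : X → ℝ≥0) (hρ : Measurable ρ) : Kernel X ℝ where
  toFun x := (ρ x : ℝ≥0∞)⁻¹ • volume.restrict (Icc (0 : ℝ) (ρ x))
  measurable' := by
    refine Measure.measurable_of_measurable_coe _ fun T hT => ?_
    have hm : Measurable fun x => volume (T ∩ Icc (0 : ℝ) (ρ x)) := by
      have hs : MeasurableSet {p : X × ℝ | p.2 ∈ T ∧ 0 ≤ p.2 ∧ p.2 ≤ ρ p.1} :=
        (measurable_snd hT).inter ((measurableSet_le measurable_const measurable_snd).inter
          (measurableSet_le measurable_snd (hρ.comp measurable_fst).coe_nnreal_real))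
      exact measurable_measure_prodMk_left hs
    simp only [Measure.smul_apply, smul_eq_mul, Measure.restrict_apply hT]
    exact hρ.coe_nnreal_ennreal.inv.mul hm

theorem levelKernel_apply (hρ : Measurable ρ) (x : X) :
    levelKernel ρ hρ x = (ρ x : ℝ≥0∞)⁻¹ • volume.restrict (Icc (0 : ℝ) (ρ x)) := rfl

theorem levelKernel_univ_eq_one (hρ : Measurable ρ) {x : X} (hx : ρ x ≠ 0) :
    levelKernel ρ hρ x univ = 1 := by
  rw [levelKernel_apply, Measure.smul_apply, Measure.restrict_apply_univ, Real.volume_Icc,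
    sub_zero, ENNReal.ofReal_coe_nnreal, smul_eq_mul]
  exact ENNReal.inv_mul_cancel (by simpa using hx) ENNReal.coe_ne_top

theorem levelKernel_univ_le_one (hρ : Measurable ρ) (x : X) : levelKernel ρ hρ x univ ≤ 1 := by
  rw [levelKernel_apply, Measure.smul_apply, Measure.restrict_apply_univ, Real.volume_Icc,
    sub_zero, ENNReal.ofReal_coe_nnreal, smul_eq_mul]
  exact ENNReal.inv_mul_le_one _

instance isFiniteKernel_levelKernel (hρ : Measurable ρ) : IsFiniteKernel (levelKernel ρ hρ) :=
  ⟨⟨1, ENNReal.one_lt_top, levelKernel_univ_le_one hρ⟩⟩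

/-- The kernel `t ↦ U_t`. -/
noncomputable def levelUniformKernel (vol : Measure X) (ρ : X → ℝ≥0) : Kernel ℝ X :=
  ⟨levelUniform vol ρ, measurable_levelUniform vol ρ⟩

theorem levelUniformKernel_apply (vol : Measure X) (ρ : X → ℝ≥0) (t : ℝ) :
    levelUniformKernel vol ρ t = levelUniform vol ρ t := rfl

theorem levelUniform_univ_le_one (vol : Measure X) (ρ : X → ℝ≥0) (t : ℝ) :
    levelUniform vol ρ t univ ≤ 1 := by
  rw [levelUniform, Measure.smul_apply, Measure.restrict_apply_univ, smul_eq_mul]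
  exact ENNReal.inv_mul_le_one _

instance isFiniteKernel_levelUniformKernel (vol : Measure X) (ρ : X → ℝ≥0) :
    IsFiniteKernel (levelUniformKernel vol ρ) :=
  ⟨⟨1, ENNReal.one_lt_top, levelUniform_univ_le_one vol ρ⟩⟩

instance isFiniteKernel_uniformKernel (vol : Measure X) (ρ : X → ℝ≥0) :
    IsFiniteKernel (uniformKernel vol ρ) :=
  ⟨⟨1, ENNReal.one_lt_top, fun p => levelUniform_univ_le_one vol ρ p.2⟩⟩

theorem isProbabilityMeasure_levelUniform {t : ℝ} (h0 : vol (levelSet ρ t) ≠ 0)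
    (h1 : vol (levelSet ρ t) ≠ ∞) : IsProbabilityMeasure (levelUniform vol ρ t) := by
  refine ⟨?_⟩
  rw [levelUniform, Measure.smul_apply, Measure.restrict_apply_univ, smul_eq_mul]
  exact ENNReal.inv_mul_cancel h0 h1

theorem measure_levelSet_lt_top (hρ : Measurable ρ) (hfin : ∫⁻ x, (ρ x : ℝ≥0∞) ∂vol ≠ ∞)
    {t : ℝ} (ht : 0 < t) : vol (levelSet ρ t) < ∞ := by
  have h : levelSet ρ t = {x | ENNReal.ofReal t ≤ (ρ x : ℝ≥0∞)} := by
    ext x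
    simp only [levelSet, mem_ofPred_eq]
    rw [← ENNReal.ofReal_coe_nnreal]
    exact (ENNReal.ofReal_le_ofReal_iff (ρ x).2).symm
  rw [h]
  exact (meas_ge_le_lintegral_div hρ.coe_nnreal_ennreal.aemeasurable (by simpa using ht)
    ENNReal.ofReal_ne_top).trans_lt (ENNReal.div_lt_top hfin (by simpa using ht))

/-- Tonelli: both sides measure the part of the region under the graph of `ρ` that lies over `A` at
heights in `T`. -/
theorem lintegral_volume_inter_Icc [SFinite vol] (hρ : Measurable ρ) (A : Set X) {T : Set ℝ}
    (hT : MeasurableSet T) :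
    ∫⁻ x in A, volume (T ∩ Icc (0 : ℝ) (ρ x)) ∂vol =
      ∫⁻ t in T, vol (A ∩ levelSet ρ t) ∂(volume.restrict (Ici (0 : ℝ))) := by
  have hs : MeasurableSet {p : X × ℝ | p.2 ≤ ρ p.1} :=
    measurableSet_le measurable_snd (hρ.comp measurable_fst).coe_nnreal_real
  calc ∫⁻ x in A, volume (T ∩ Icc (0 : ℝ) (ρ x)) ∂vol
      = ((vol.restrict A).prod ((volume.restrict (Ici (0 : ℝ))).restrict T))
          {p : X × ℝ | p.2 ≤ ρ p.1} := by
        rw [Measure.prod_apply hs]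
        refine lintegral_congr fun x => ?_
        rw [Measure.restrict_apply (measurable_prodMk_left hs), Measure.restrict_apply
          ((measurable_prodMk_left hs).inter hT)]
        congr 1
        ext t
        simp only [mem_inter_iff, mem_Icc, mem_preimage, mem_ofPred_eq, mem_Ici]
        tauto
    _ = ∫⁻ t in T, vol (A ∩ levelSet ρ t) ∂(volume.restrict (Ici (0 : ℝ))) := by
        rw [Measure.prod_apply_symm hs]
        refine lintegral_congr fun t => ?_
        rw [Measure.restrict_apply (measurable_prodMk_right hs), inter_comm]
        rfl

theorem lintegral_measure_levelSet [SFinite vol] (hρ : Measurable ρ) :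
    ∫⁻ t in Ici (0 : ℝ), vol (levelSet ρ t) = ∫⁻ x, (ρ x : ℝ≥0∞) ∂vol := by
  have h := lintegral_volume_inter_Icc (vol := vol) hρ univ MeasurableSet.univ
  simpa using h.symm

theorem isProbabilityMeasure_target (h0 : ∫⁻ x, (ρ x : ℝ≥0∞) ∂vol ≠ 0)
    (hfin : ∫⁻ x, (ρ x : ℝ≥0∞) ∂vol ≠ ∞) : IsProbabilityMeasure (target vol ρ) := by
  refine ⟨?_⟩
  rw [target, Measure.smul_apply, withDensity_apply _ MeasurableSet.univ, Measure.restrict_univ,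
    smul_eq_mul]
  exact ENNReal.inv_mul_cancel h0 hfin

instance isFiniteMeasure_target (vol : Measure X) (ρ : X → ℝ≥0) :
    IsFiniteMeasure (target vol ρ) := by
  refine ⟨?_⟩
  rw [target, Measure.smul_apply, withDensity_apply _ MeasurableSet.univ, Measure.restrict_univ,
    smul_eq_mul]
  exact (ENNReal.inv_mul_le_one _).trans_lt ENNReal.one_lt_top

instance isFiniteMeasure_levelLaw (vol : Measure X) (ρ : X → ℝ≥0) :
    IsFiniteMeasure (levelLaw vol ρ) := by
  refine ⟨?_⟩
  rw [levelLaw, withDensity_apply _ MeasurableSet.univ, Measure.restrict_univ]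
  simp only [div_eq_mul_inv]
  rw [lintegral_mul_const _ (measurable_measure_levelSet vol ρ)]
  exact (ENNReal.div_self_le_one (a := ∫⁻ s in Ici (0 : ℝ), vol (levelSet ρ s))).trans_lt
    ENNReal.one_lt_top

theorem ae_target_ne_zero (vol : Measure X) (hρ : Measurable ρ) :
    ∀ᵐ x ∂(target vol ρ), ρ x ≠ 0 := by
  refine Measure.ae_smul_measure ?_ _
  rw [ae_withDensity_iff hρ.coe_nnreal_ennreal]
  exact Eventually.of_forall fun x hx => by simpa using hx

theorem ae_levelLaw_of_forall {p : ℝ → Prop}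
    (h : ∀ t, 0 < t → vol (levelSet ρ t) ≠ 0 → p t) : ∀ᵐ t ∂(levelLaw vol ρ), p t := by
  rw [levelLaw, ae_withDensity_iff ((measurable_measure_levelSet vol ρ).div_const _),
    ae_restrict_iff' measurableSet_Ici]
  filter_upwards [Measure.ae_ne volume (0 : ℝ)] with t ht ht0 hv
  refine h t (lt_of_le_of_ne ht0 ht.symm) fun h0 => hv ?_
  rw [h0, ENNReal.zero_div]

/-- The density of `ℓ` is nonzero wherever the level set has positive volume, because its
normalising constant is finite. This brings level-wise facts to the Lebesgue integrals inside
`beta`. -/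
theorem ae_volume_of_ae_levelLaw [SFinite vol] (hρ : Measurable ρ)
    (hfin : ∫⁻ x, (ρ x : ℝ≥0∞) ∂vol ≠ ∞) {p : ℝ → Prop} (h : ∀ᵐ t ∂(levelLaw vol ρ), p t) :
    ∀ᵐ t : ℝ, 0 < t → vol (levelSet ρ t) ≠ 0 → p t := by
  rw [levelLaw, ae_withDensity_iff ((measurable_measure_levelSet vol ρ).div_const _),
    ae_restrict_iff' measurableSet_Ici, lintegral_measure_levelSet hρ] at h
  filter_upwards [h] with t ht h0 hv
  exact ht h0.le (ENNReal.div_pos hv hfin).ne'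

/-- The density `ρ(x)` cancels the normalisation of the uniform law on `[0, ρ(x)]`, and `vol(K(t))`
cancels that of `U_t`. Each side becomes the volume under the graph of `ρ`, divided by `∫ ρ`. -/
theorem map_swap_target_compProd [SFinite vol] (hρ : Measurable ρ)
    (hfin : ∫⁻ x, (ρ x : ℝ≥0∞) ∂vol ≠ ∞) :
    (target vol ρ ⊗ₘ levelKernel ρ hρ).map Prod.swap =
      levelLaw vol ρ ⊗ₘ levelUniformKernel vol ρ := by
  refine Measure.ext_prod fun {T A} hT hA => ?_
  have hl : (target vol ρ ⊗ₘ levelKernel ρ hρ) (A ×ˢ T) =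
      (∫⁻ x, (ρ x : ℝ≥0∞) ∂vol)⁻¹ * ∫⁻ x in A, volume (T ∩ Icc (0 : ℝ) (ρ x)) ∂vol := by
    rw [Measure.compProd_apply_prod hA hT, target, Measure.restrict_smul, lintegral_smul_measure,
      smul_eq_mul, setLIntegral_withDensity_eq_setLIntegral_mul _ hρ.coe_nnreal_ennreal
        ((levelKernel ρ hρ).measurable_coe hT) hA]
    congr 1
    refine lintegral_congr fun x => ?_
    rw [Pi.mul_apply, levelKernel_apply, Measure.smul_apply, Measure.restrict_apply hT,
      smul_eq_mul, ← mul_assoc]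
    -- Where `ρ` vanishes nothing cancels, but the interval `[0, ρ(x)]` is then a null set.
    by_cases hx : ρ x = 0
    · have : volume (T ∩ Icc (0 : ℝ) (ρ x)) = 0 := by
        refine measure_mono_null inter_subset_right ?_
        simp [hx]
      rw [this, mul_zero]
    · rw [ENNReal.mul_inv_cancel (by simpa using hx) ENNReal.coe_ne_top, one_mul]
  have hr : (levelLaw vol ρ ⊗ₘ levelUniformKernel vol ρ) (T ×ˢ A) =
      (∫⁻ x, (ρ x : ℝ≥0∞) ∂vol)⁻¹ *
        ∫⁻ t in T, vol (A ∩ levelSet ρ t) ∂(volume.restrict (Ici (0 : ℝ))) := by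
    have hmA : Measurable fun t => vol (A ∩ levelSet ρ t) :=
      Antitone.measurable fun _ _ hst => measure_mono
        (inter_subset_inter_right _ fun _ hx => hst.trans hx)
    rw [Measure.compProd_apply_prod hT hA, levelLaw,
      setLIntegral_withDensity_eq_setLIntegral_mul _
        ((measurable_measure_levelSet vol ρ).div_const _)
        ((levelUniformKernel vol ρ).measurable_coe hA) hT, lintegral_measure_levelSet hρ,
      ← lintegral_const_mul _ hmA]
    refine lintegral_congr_ae (ae_restrict_of_ae ?_)
    refine (ae_restrict_iff' measurableSet_Ici).2 ?_
    filter_upwards [Measure.ae_ne volume (0 : ℝ)] with t ht ht0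
    have htop := (measure_levelSet_lt_top hρ hfin (lt_of_le_of_ne ht0 ht.symm)).ne
    rw [Pi.mul_apply, levelUniformKernel_apply, levelUniform, Measure.smul_apply,
      Measure.restrict_apply hA, smul_eq_mul, div_eq_mul_inv]
    by_cases hv : vol (levelSet ρ t) = 0
    · rw [measure_mono_null inter_subset_right hv]
      simp
    · rw [mul_comm (vol (levelSet ρ t)), mul_assoc, ← mul_assoc (vol (levelSet ρ t)),
        ENNReal.mul_inv_cancel hv htop, one_mul]
  rw [Measure.map_apply measurable_swap (hT.prod hA), preimage_swap_prod, hl, hr,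
    lintegral_volume_inter_Icc hρ A hT]

end Disintegration

/-! ### Sections and partial integrals of functions on a composition product. -/

section CompProd

variable {X Y : Type*} [MeasurableSpace X] [MeasurableSpace Y] {μ : Measure X} [SFinite μ]
  {κ : Kernel X Y} [IsSFiniteKernel κ]

theorem ae_memLp_of_memLp_compProd {h : X × Y → ℝ} (hh : MemLp h 2 (μ ⊗ₘ κ)) :
    ∀ᵐ x ∂μ, MemLp (fun y => h (x, y)) 2 (κ x) := by
  have h1 := (memLp_two_iff_integrable_sq hh.1).1 hh
  have h2 : ∀ᵐ x ∂μ, AEStronglyMeasurable (fun y => h (x, y)) (κ x) :=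
    AEStronglyMeasurable.ae_of_compProd (f := fun x y => h (x, y)) hh.1
  filter_upwards [((Measure.integrable_compProd_iff h1.1).1 h1).1, h2] with x hx hx2
  exact (memLp_two_iff_integrable_sq hx2).2 hx

theorem integrable_integral_of_integrable_compProd {h : X × Y → ℝ}
    (hh : Integrable h (μ ⊗ₘ κ)) : Integrable (fun x => ∫ y, h (x, y) ∂(κ x)) μ := by
  rw [Measure.compProd] at hh
  simpa using hh.integral_compProd

end CompProd

/-! ### Exchanging the order of point and level. -/

section JointLaw

variable {X : Type*} [MeasurableSpace X] {vol : Measure X} {ρ : X → ℝ≥0} [SFinite vol]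

theorem measurePreserving_snd_jointLaw (hρ : Measurable ρ)
    (hfin : ∫⁻ x, (ρ x : ℝ≥0∞) ∂vol ≠ ∞) :
    MeasurePreserving Prod.snd (levelLaw vol ρ ⊗ₘ levelUniformKernel vol ρ) (target vol ρ) := by
  refine ⟨measurable_snd, ?_⟩
  rw [← map_swap_target_compProd hρ hfin, Measure.map_map measurable_snd measurable_swap]
  exact map_fst_compProd_of_ae_eq_one
    ((ae_target_ne_zero vol hρ).mono fun x hx => levelKernel_univ_eq_one hρ hx)

theorem lintegral_jointLaw (hρ : Measurable ρ) (hfin : ∫⁻ x, (ρ x : ℝ≥0∞) ∂vol ≠ ∞)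
    {F : ℝ × X → ℝ≥0∞} (hF : Measurable F) :
    ∫⁻ x, ∫⁻ t, F (t, x) ∂(levelKernel ρ hρ x) ∂(target vol ρ) =
      ∫⁻ t, ∫⁻ x, F (t, x) ∂(levelUniform vol ρ t) ∂(levelLaw vol ρ) := by
  have h1 := Measure.lintegral_compProd (μ := target vol ρ) (κ := levelKernel ρ hρ)
    (hF.comp measurable_swap)
  have h2 := Measure.lintegral_compProd (μ := levelLaw vol ρ) (κ := levelUniformKernel vol ρ) hF
  rw [← map_swap_target_compProd hρ hfin, lintegral_map hF measurable_swap] at h2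
  exact h1.symm.trans h2

theorem integral_jointLaw (hρ : Measurable ρ) (hfin : ∫⁻ x, (ρ x : ℝ≥0∞) ∂vol ≠ ∞)
    {F : ℝ × X → ℝ} (hF : Integrable F (levelLaw vol ρ ⊗ₘ levelUniformKernel vol ρ)) :
    ∫ x, ∫ t, F (t, x) ∂(levelKernel ρ hρ x) ∂(target vol ρ) =
      ∫ t, ∫ x, F (t, x) ∂(levelUniform vol ρ t) ∂(levelLaw vol ρ) := by
  have hm : MeasurableEmbedding (Prod.swap : X × ℝ → ℝ × X) :=
    MeasurableEquiv.prodComm.measurableEmbedding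
  have h2 := Measure.integral_compProd hF
  rw [← map_swap_target_compProd hρ hfin] at hF h2
  rw [hm.integral_map] at h2
  have h1 := Measure.integral_compProd (hm.integrable_map_iff.1 hF)
  exact h1.symm.trans h2

end JointLaw

/-! ### Level-wise operators and the quadratic form of the slice sampler. -/

section SliceFamily

variable {X : Type*} [MeasurableSpace X] {vol : Measure X} {ρ : X → ℝ≥0}
  {G : Kernel (X × ℝ) X}

theorem ae_memLp_levelUniform {h : ℝ × X → ℝ}
    (hh : MemLp h 2 (levelLaw vol ρ ⊗ₘ levelUniformKernel vol ρ)) :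
    ∀ᵐ t ∂(levelLaw vol ρ), MemLp (fun x => h (t, x)) 2 (levelUniform vol ρ t) := by
  have h1 := ae_memLp_of_memLp_compProd hh
  exact h1

/-- For almost every level `t`, the kernel `G_t` is Markov and reversible with respect to `U_t`. -/
def IsReversibleFamily (vol : Measure X) (ρ : X → ℝ≥0) (G : Kernel (X × ℝ) X) : Prop :=
  ∀ᵐ t ∂(levelLaw vol ρ), (∀ᵐ x ∂(levelUniform vol ρ t), G.sectL t x univ = 1) ∧
    (G.sectL t).IsReversible (levelUniform vol ρ t)

theorem ae_isProbabilityMeasure_levelUniform (hρ : Measurable ρ)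
    (hfin : ∫⁻ x, (ρ x : ℝ≥0∞) ∂vol ≠ ∞) :
    ∀ᵐ t ∂(levelLaw vol ρ), IsProbabilityMeasure (levelUniform vol ρ t) :=
  ae_levelLaw_of_forall fun _ ht hv =>
    isProbabilityMeasure_levelUniform hv (measure_levelSet_lt_top hρ hfin ht).ne

theorem isReversibleFamily_uniformKernel (hρ : Measurable ρ)
    (hfin : ∫⁻ x, (ρ x : ℝ≥0∞) ∂vol ≠ ∞) :
    IsReversibleFamily vol ρ (uniformKernel vol ρ) := by
  filter_upwards [ae_isProbabilityMeasure_levelUniform hρ hfin] with t ht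
  exact ⟨Eventually.of_forall fun x => ht.measure_univ, isReversible_const _⟩

theorem sliceOp_uniformKernel (vol : Measure X) (ρ : X → ℝ≥0) (t : ℝ) :
    sliceOp vol ρ (uniformKernel vol ρ) t = meanOp (levelUniform vol ρ t) := rfl

/-- One step of the sampler draws a level below the graph and then moves by `G` at that level; this
form gives access to integration against composed kernels. -/
theorem sliceSampler_eq_bind (hρ : Measurable ρ) (G : Kernel (X × ℝ) X) (x : X) :
    sliceSampler ρ hρ G x = (G.sectR x ∘ₖ levelKernel ρ hρ) x := by
  ext A hA
  rw [sliceSampler_apply hρ G x hA, Kernel.comp_apply' _ _ _ hA, levelKernel_apply,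
    lintegral_smul_measure]
  rfl

theorem sliceSampler_apply_eq_lintegral (hρ : Measurable ρ) (G : Kernel (X × ℝ) X) (x : X)
    {A : Set X} (hA : MeasurableSet A) :
    sliceSampler ρ hρ G x A = ∫⁻ t, G (x, t) A ∂(levelKernel ρ hρ x) := by
  rw [sliceSampler_eq_bind, Kernel.comp_apply' _ _ _ hA]
  rfl

instance isFiniteKernel_sliceSampler (hρ : Measurable ρ) (G : Kernel (X × ℝ) X)
    [IsFiniteKernel G] : IsFiniteKernel (sliceSampler ρ hρ G) := by
  refine ⟨⟨G.bound, G.bound_lt_top, fun x => ?_⟩⟩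
  rw [sliceSampler_apply_eq_lintegral hρ G x MeasurableSet.univ]
  calc ∫⁻ t, G (x, t) univ ∂(levelKernel ρ hρ x)
      ≤ ∫⁻ _, G.bound ∂(levelKernel ρ hρ x) := lintegral_mono fun t => G.measure_le_bound _ _
    _ ≤ G.bound := by
        rw [lintegral_const]
        exact mul_le_of_le_one_right' (levelKernel_univ_le_one hρ x)

/-- The operator `h(x, t) ↦ ∫ h(y, t) G_t(x, dy)` on functions of a level and a point. -/
noncomputable def levelwise (G : Kernel (X × ℝ) X) (h : ℝ × X → ℝ) : ℝ × X → ℝ :=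
  fun p => ∫ y, h (p.1, y) ∂(G (p.2, p.1))

/-- The exceptional set of levels does not depend on `h`, so the statement can be applied to every
iterate of `levelwise`. -/
theorem ae_sliceOp_toLp (hG : IsReversibleFamily vol ρ G) :
    ∀ᵐ t ∂(levelLaw vol ρ), ∀ (h : ℝ × X → ℝ)
      (h1 : MemLp (fun x => h (t, x)) 2 (levelUniform vol ρ t))
      (h2 : MemLp (fun x => levelwise G h (t, x)) 2 (levelUniform vol ρ t)),
      sliceOp vol ρ G t (h1.toLp _) = h2.toLp _ := by
  filter_upwards [hG] with t ht h h1 h2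
  exact Lp.ext ((markovOp_toLp_ae ht.1 ht.2 h1).trans h2.coeFn_toLp.symm)

theorem stronglyMeasurable_levelwise [IsFiniteKernel G] {h : ℝ × X → ℝ}
    (hh : StronglyMeasurable h) : StronglyMeasurable (levelwise G h) := by
  have hf : StronglyMeasurable fun q : (ℝ × X) × X => h (q.1.1, q.2) :=
    hh.comp_measurable (measurable_fst.fst.prodMk measurable_snd)
  have := hf.integral_kernel_prod_right' (κ := G.swapLeft)
  exact this

/-- Each `G_t` contracts `L²(U_t)`; integrate the squared norms over the levels. -/
theorem memLp_levelwise [IsFiniteKernel G] (hG : IsReversibleFamily vol ρ G) {h : ℝ × X → ℝ}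
    (hh : StronglyMeasurable h)
    (hL : MemLp h 2 (levelLaw vol ρ ⊗ₘ levelUniformKernel vol ρ)) :
    MemLp (levelwise G h) 2 (levelLaw vol ρ ⊗ₘ levelUniformKernel vol ρ) := by
  have hm := stronglyMeasurable_levelwise (G := G) hh
  have key : ∀ {g : ℝ × X → ℝ}, StronglyMeasurable g →
      ∫⁻ p, ‖g p‖ₑ ^ (2 : ℝ) ∂(levelLaw vol ρ ⊗ₘ levelUniformKernel vol ρ) =
        ∫⁻ t, ∫⁻ x, ‖g (t, x)‖ₑ ^ (2 : ℝ) ∂(levelUniform vol ρ t) ∂(levelLaw vol ρ) :=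
    fun hg => Measure.lintegral_compProd (hg.enorm.pow_const _)
  refine ⟨hm.aestronglyMeasurable, ?_⟩
  rw [eLpNorm_lt_top_iff_lintegral_rpow_enorm_lt_top (by norm_num) (by norm_num)]
  have hlt := (eLpNorm_lt_top_iff_lintegral_rpow_enorm_lt_top (by norm_num) (by norm_num)).1 hL.2
  simp only [ENNReal.toReal_ofNat] at hlt ⊢
  rw [key hh] at hlt
  rw [key hm]
  refine (lintegral_mono_ae ?_).trans_lt hlt
  filter_upwards [hG, ae_memLp_levelUniform hL] with t ht hLt
  have h1 := eLpNorm_integral_le (ht.1.mono fun _ hx => hx.le)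
    (invariant_of_isReversible ht.1 ht.2) hLt
  rw [eLpNorm_eq_lintegral_rpow_enorm_toReal (by norm_num) (by norm_num),
    eLpNorm_eq_lintegral_rpow_enorm_toReal (by norm_num) (by norm_num)] at h1
  simp only [ENNReal.toReal_ofNat] at h1
  exact (ENNReal.rpow_le_rpow_iff (by norm_num)).1 h1

theorem memLp_iterate_levelwise [IsFiniteKernel G] (hG : IsReversibleFamily vol ρ G)
    {h : ℝ × X → ℝ} (hh : StronglyMeasurable h)
    (hL : MemLp h 2 (levelLaw vol ρ ⊗ₘ levelUniformKernel vol ρ)) (n : ℕ) :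
    StronglyMeasurable ((levelwise G)^[n] h) ∧
      MemLp ((levelwise G)^[n] h) 2 (levelLaw vol ρ ⊗ₘ levelUniformKernel vol ρ) := by
  induction n with
  | zero => exact ⟨hh, hL⟩
  | succ n ih =>
    rw [Function.iterate_succ_apply']
    exact ⟨stronglyMeasurable_levelwise ih.1, memLp_levelwise hG ih.1 ih.2⟩

/-- The operators at different levels act on different spaces. Representing their powers by iterates
of one map on functions of `(t, x)` provides joint measurability. -/
theorem ae_sliceOp_pow_toLp [IsFiniteKernel G] (hG : IsReversibleFamily vol ρ G)
    {h : ℝ × X → ℝ} (hh : StronglyMeasurable h)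
    (hL : MemLp h 2 (levelLaw vol ρ ⊗ₘ levelUniformKernel vol ρ)) (n : ℕ) :
    ∀ᵐ t ∂(levelLaw vol ρ), ∀ (h1 : MemLp (fun x => h (t, x)) 2 (levelUniform vol ρ t))
      (h2 : MemLp (fun x => (levelwise G)^[n] h (t, x)) 2 (levelUniform vol ρ t)),
      (sliceOp vol ρ G t ^ n) (h1.toLp _) = h2.toLp _ := by
  induction n with
  | zero => exact Eventually.of_forall fun t h1 h2 => rfl
  | succ n ih =>
    filter_upwards [ih, ae_sliceOp_toLp hG,
      ae_memLp_levelUniform (memLp_iterate_levelwise hG hh hL n).2] with t ht hs hn h1 h2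
    simp only [Function.iterate_succ_apply'] at h2 ⊢
    rw [pow_succ', mul_apply_eq_comp, ht h1 hn]
    exact hs _ hn h2

/-- `t ↦ ⟨G_t ^ n f, f⟩` in `L²(U_t)`, as an explicit integral. -/
noncomputable def levelMoment (vol : Measure X) (ρ : X → ℝ≥0) (G : Kernel (X × ℝ) X) (f : X → ℝ)
    (n : ℕ) (t : ℝ) : ℝ :=
  ∫ x, f x * (levelwise G)^[n] (fun p => f p.2) (t, x) ∂(levelUniform vol ρ t)

variable [SFinite vol]

theorem setLIntegral_sliceSampler (hρ : Measurable ρ) (hfin : ∫⁻ x, (ρ x : ℝ≥0∞) ∂vol ≠ ∞)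
    (G : Kernel (X × ℝ) X) {A B : Set X} (hA : MeasurableSet A) (hB : MeasurableSet B) :
    ∫⁻ x in A, sliceSampler ρ hρ G x B ∂(target vol ρ) =
      ∫⁻ t, ∫⁻ x in A, G.sectL t x B ∂(levelUniform vol ρ t) ∂(levelLaw vol ρ) := by
  have hF : Measurable fun p : ℝ × X => A.indicator (fun x => G (x, p.1) B) p.2 :=
    Measurable.indicator ((G.measurable_coe hB).comp measurable_swap) (measurable_snd hA)
  rw [← lintegral_indicator hA]
  calc ∫⁻ x, A.indicator (fun x => sliceSampler ρ hρ G x B) x ∂(target vol ρ)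
      = ∫⁻ x, ∫⁻ t, A.indicator (fun x => G (x, t) B) x ∂(levelKernel ρ hρ x)
          ∂(target vol ρ) := by
        refine lintegral_congr fun x => ?_
        by_cases hx : x ∈ A
        · simp only [indicator_of_mem hx]
          exact sliceSampler_apply_eq_lintegral hρ G x hB
        · simp [indicator_of_notMem hx]
    _ = ∫⁻ t, ∫⁻ x, A.indicator (fun x => G (x, t) B) x ∂(levelUniform vol ρ t)
          ∂(levelLaw vol ρ) := lintegral_jointLaw hρ hfin hF
    _ = ∫⁻ t, ∫⁻ x in A, G.sectL t x B ∂(levelUniform vol ρ t) ∂(levelLaw vol ρ) := by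
        refine lintegral_congr fun t => ?_
        rw [lintegral_indicator hA]
        rfl

/-- The flow from `A` to `B` is the `ℓ`-average of the flows within the levels, and each of these is
symmetric. -/
theorem isReversible_sliceSampler (hρ : Measurable ρ) (hfin : ∫⁻ x, (ρ x : ℝ≥0∞) ∂vol ≠ ∞)
    (hG : IsReversibleFamily vol ρ G) :
    (sliceSampler ρ hρ G).IsReversible (target vol ρ) := by
  intro A B hA hB
  rw [setLIntegral_sliceSampler hρ hfin G hA hB, setLIntegral_sliceSampler hρ hfin G hB hA]
  exact lintegral_congr_ae (hG.mono fun t ht => ht.2 hA hB)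

theorem ae_sliceSampler_univ (hρ : Measurable ρ) (hfin : ∫⁻ x, (ρ x : ℝ≥0∞) ∂vol ≠ ∞)
    (hG : IsReversibleFamily vol ρ G) :
    ∀ᵐ x ∂(target vol ρ), sliceSampler ρ hρ G x univ = 1 := by
  have hm : MeasurableSet {p : ℝ × X | G (p.2, p.1) univ = 1} :=
    (G.measurable_coe MeasurableSet.univ).comp measurable_swap (measurableSet_singleton 1)
  have h1 : ∀ᵐ p ∂(levelLaw vol ρ ⊗ₘ levelUniformKernel vol ρ), G (p.2, p.1) univ = 1 :=
    Measure.ae_compProd_of_ae_ae hm (hG.mono fun t ht => ht.1)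
  rw [← map_swap_target_compProd hρ hfin, ae_map_iff measurable_swap.aemeasurable hm] at h1
  filter_upwards [Measure.ae_ae_of_ae_compProd h1, ae_target_ne_zero vol hρ] with x hx hx0
  have hx1 : ∫⁻ t, G (x, t) univ ∂(levelKernel ρ hρ x) = ∫⁻ _, 1 ∂(levelKernel ρ hρ x) :=
    lintegral_congr_ae hx
  rw [sliceSampler_apply_eq_lintegral hρ G x MeasurableSet.univ, hx1, lintegral_const, one_mul,
    levelKernel_univ_eq_one hρ hx0]

theorem memLp_comp_snd (hρ : Measurable ρ) (hfin : ∫⁻ x, (ρ x : ℝ≥0∞) ∂vol ≠ ∞) {f : X → ℝ}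
    (hL : MemLp f 2 (target vol ρ)) :
    MemLp (fun p : ℝ × X => f p.2) 2 (levelLaw vol ρ ⊗ₘ levelUniformKernel vol ρ) :=
  hL.comp_measurePreserving (measurePreserving_snd_jointLaw hρ hfin)

theorem stronglyMeasurable_levelMoment [IsFiniteKernel G] (hG : IsReversibleFamily vol ρ G)
    (hρ : Measurable ρ) (hfin : ∫⁻ x, (ρ x : ℝ≥0∞) ∂vol ≠ ∞) {f : X → ℝ}
    (hf : StronglyMeasurable f) (hL : MemLp f 2 (target vol ρ)) (n : ℕ) :
    StronglyMeasurable (levelMoment vol ρ G f n) := by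
  have h := ((hf.comp_measurable measurable_snd).mul (memLp_iterate_levelwise hG
    (hf.comp_measurable measurable_snd) (memLp_comp_snd hρ hfin hL) n).1).integral_kernel_prod_right'
      (κ := levelUniformKernel vol ρ)
  exact h

theorem integrable_mul_iterate_levelwise [IsFiniteKernel G] (hG : IsReversibleFamily vol ρ G)
    (hρ : Measurable ρ) (hfin : ∫⁻ x, (ρ x : ℝ≥0∞) ∂vol ≠ ∞) {f : X → ℝ}
    (hf : StronglyMeasurable f) (hL : MemLp f 2 (target vol ρ)) (n : ℕ) :
    Integrable (fun p : ℝ × X => f p.2 * (levelwise G)^[n] (fun p => f p.2) p)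
      (levelLaw vol ρ ⊗ₘ levelUniformKernel vol ρ) :=
  (memLp_comp_snd hρ hfin hL).integrable_mul (memLp_iterate_levelwise hG
    (hf.comp_measurable measurable_snd) (memLp_comp_snd hρ hfin hL) n).2

theorem integrable_levelMoment [IsFiniteKernel G] (hG : IsReversibleFamily vol ρ G)
    (hρ : Measurable ρ) (hfin : ∫⁻ x, (ρ x : ℝ≥0∞) ∂vol ≠ ∞) {f : X → ℝ}
    (hf : StronglyMeasurable f) (hL : MemLp f 2 (target vol ρ)) (n : ℕ) :
    Integrable (levelMoment vol ρ G f n) (levelLaw vol ρ) :=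
  integrable_integral_of_integrable_compProd (integrable_mul_iterate_levelwise hG hρ hfin hf hL n)

theorem ae_levelMoment_eq_inner [IsFiniteKernel G] (hG : IsReversibleFamily vol ρ G)
    (hρ : Measurable ρ) (hfin : ∫⁻ x, (ρ x : ℝ≥0∞) ∂vol ≠ ∞) {f : X → ℝ}
    (hf : StronglyMeasurable f) (hL : MemLp f 2 (target vol ρ)) (n : ℕ) :
    ∀ᵐ t ∂(levelLaw vol ρ), ∀ h : MemLp f 2 (levelUniform vol ρ t),
      levelMoment vol ρ G f n t = inner ℝ ((sliceOp vol ρ G t ^ n) (h.toLp f)) (h.toLp f) := by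
  have hs : StronglyMeasurable fun p : ℝ × X => f p.2 := hf.comp_measurable measurable_snd
  have hLs := memLp_comp_snd hρ hfin hL
  filter_upwards [ae_sliceOp_pow_toLp hG hs hLs n,
    ae_memLp_levelUniform (memLp_iterate_levelwise hG hs hLs n).2] with t ht hn h
  have h1 : (sliceOp vol ρ G t ^ n) (h.toLp f) = hn.toLp _ := ht h hn
  rw [h1, L2.inner_def]
  refine integral_congr_ae ?_
  filter_upwards [h.coeFn_toLp, hn.coeFn_toLp] with x h2 h3
  rw [h2, h3]
  rfl

/-- Expand `Hf(x)` as an average over levels in `[0, ρ(x)]`, then exchange the order of point and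
level. -/
theorem inner_sliceSampler_eq_integral [IsFiniteKernel G] (hG : IsReversibleFamily vol ρ G)
    (hρ : Measurable ρ) (hfin : ∫⁻ x, (ρ x : ℝ≥0∞) ∂vol ≠ ∞) {f : X → ℝ}
    (hf : StronglyMeasurable f) (hL : MemLp f 2 (target vol ρ)) :
    inner ℝ (markovOp (sliceSampler ρ hρ G) (target vol ρ) (hL.toLp f)) (hL.toLp f) =
      ∫ t, levelMoment vol ρ G f 1 t ∂(levelLaw vol ρ) := by
  have h1 := ae_sliceSampler_univ hρ hfin hG
  have hrev := isReversible_sliceSampler hρ hfin hG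
  have hint := integral_jointLaw hρ hfin
    (integrable_mul_iterate_levelwise hG hρ hfin hf hL 1)
  refine Eq.trans ?_ hint
  rw [L2.inner_def]
  refine integral_congr_ae ?_
  filter_upwards [markovOp_toLp_ae h1 hrev hL, hL.coeFn_toLp, ae_integrable_of_invariant
    (h1.mono fun _ hx => hx.le) (invariant_of_isReversible h1 hrev) hL] with x h2 h3 h4
  rw [h2, h3, integral_const_mul]
  rw [sliceSampler_eq_bind] at h4 ⊢
  rw [Kernel.integral_comp h4]
  simp [levelwise]

theorem integral_levelMoment_zero [IsFiniteKernel G] (hG : IsReversibleFamily vol ρ G)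
    (hρ : Measurable ρ) (hfin : ∫⁻ x, (ρ x : ℝ≥0∞) ∂vol ≠ ∞) {f : X → ℝ}
    (hf : StronglyMeasurable f) (hL : MemLp f 2 (target vol ρ)) :
    ∫ t, levelMoment vol ρ G f 0 t ∂(levelLaw vol ρ) = ‖hL.toLp f‖ ^ 2 := by
  have hint := Measure.integral_compProd (integrable_mul_iterate_levelwise hG hρ hfin hf hL 0)
  refine hint.symm.trans ?_
  rw [← real_inner_self_eq_norm_sq, L2.inner_def]
  have hmp := measurePreserving_snd_jointLaw (vol := vol) hρ hfin
  calc ∫ p : ℝ × X, f p.2 * f p.2 ∂(levelLaw vol ρ ⊗ₘ levelUniformKernel vol ρ)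
      = ∫ x, f x * f x ∂(target vol ρ) := by
        rw [← hmp.map_eq]
        exact (integral_map measurable_snd.aemeasurable (hf.mul hf).aestronglyMeasurable).symm
    _ = _ := by
        refine integral_congr_ae ?_
        filter_upwards [hL.coeFn_toLp] with x h2
        rw [h2]
        rfl

end SliceFamily

/-! ### From inequalities of quadratic forms to norms on the complement of the constants. -/

section NormComparison

variable {E : Type*} [NormedAddCommGroup E] [InnerProductSpace ℝ E] {A B M : E →L[ℝ] E}

theorem isSymmetric_sub (hA : A.IsSymmetric) (hM : M.IsSymmetric) : (A - M).IsSymmetric := by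
  rw [ContinuousLinearMap.toLinearMap_sub]
  exact LinearMap.IsSymmetric.sub hA hM

theorem norm_sub_proj_le_norm_sub_proj (hA : A.IsSymmetric) (hM : M.IsSymmetric)
    (hMM : M * M = M) (hAM : A * M = M) (hMA : M * A = M)
    (hpos : ∀ f, 0 ≤ inner ℝ (A f) f) (hle : ∀ f, inner ℝ (A f) f ≤ inner ℝ (B f) f) :
    ‖A - M‖ ≤ ‖B - M‖ := by
  refine opNorm_le_of_inner_self_le (isSymmetric_sub hA hM) (fun f => ?_) (norm_nonneg _)
    fun f => ?_
  · rw [inner_sub_proj_self hM hMM hAM hMA]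
    exact hpos _
  · refine le_trans ?_ (inner_apply_self_le (B - M) f)
    rw [sub_apply, sub_apply, inner_sub_left, inner_sub_left]
    exact sub_le_sub_right (hle f) _

theorem div_le_one_sub_norm_sub_proj (hB : B.IsSymmetric) (hM : M.IsSymmetric)
    (hMM : M * M = M) (hBM : B * M = M) (hMB : M * B = M) (hpos : ∀ f, 0 ≤ inner ℝ (B f) f)
    {b : ℝ} (hb : 0 ≤ b) {k : ℕ} (hk : 1 ≤ k)
    (hle : ∀ f, (1 - b) * ‖f‖ ^ 2 - inner ℝ (A f) f ≤ k * (‖f‖ ^ 2 - inner ℝ (B f) f)) :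
    (1 - ‖A - M‖ - b) / k ≤ 1 - ‖B - M‖ := by
  have hk1 : (1 : ℝ) ≤ k := by exact_mod_cast hk
  have hk0 : (0 : ℝ) < k := by linarith
  -- The bound on `‖B - M‖` that is equivalent to the goal. It is nonnegative because `k * c = (k -
  -- 1) + ‖A - M‖ + b` and `k ≥ 1`.
  set c : ℝ := 1 - (1 - ‖A - M‖ - b) / k with hc_def
  have hkc : k * c = k - 1 + ‖A - M‖ + b := by
    rw [hc_def]
    field_simp
    ring
  have hc : 0 ≤ c := by
    by_contra! h
    nlinarith [norm_nonneg (A - M), mul_neg_of_pos_of_neg hk0 h]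
  have h : ‖B - M‖ ≤ c := by
    refine opNorm_le_of_inner_self_le (isSymmetric_sub hB hM) (fun f => ?_) hc fun f => ?_
    · rw [inner_sub_proj_self hM hMM hBM hMB]
      exact hpos _
    · rw [inner_sub_proj_self hM hMM hBM hMB]
      have hMf : M (f - M f) = 0 := by
        rw [map_sub, ← mul_apply_eq_comp M M, hMM, sub_self]
      have h1 := inner_apply_self_le (A - M) (f - M f)
      rw [sub_apply, hMf, sub_zero] at h1
      -- The hypothesis is used only on the kernel of `M`, where `A` and `A - M` agree.
      have h2 := hle (f - M f)
      have h3 : ‖f - M f‖ ^ 2 ≤ ‖f‖ ^ 2 := by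
        gcongr
        exact norm_sub_proj_apply_le hM hMM f
      have h4 : k * inner ℝ (B (f - M f)) (f - M f) ≤ k * (c * ‖f - M f‖ ^ 2) := by
        rw [← mul_assoc, hkc]
        linarith
      exact (le_of_mul_le_mul_left h4 hk0).trans (mul_le_mul_of_nonneg_left h3 hc)
  linarith

end NormComparison

/-! ### Level-wise bounds, their integration, and the comparison of the gaps. -/

section Comparison

variable {X : Type*} [MeasurableSpace X] {vol : Measure X} {ρ : X → ℝ≥0} {G : Kernel (X × ℝ) X}

theorem levelMoment_zero_eq (f : X → ℝ) (t : ℝ) :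
    levelMoment vol ρ G f 0 t = ∫ x, f x * f x ∂(levelUniform vol ρ t) := rfl

/-- Cauchy-Schwarz against the constant `1` for the uniform law on `[0, ρ(x)]`. The measurable
minorant `r` stands in for the operator norm, so measurability of the norm in `t` is never needed.
-/
theorem lintegral_levelKernel_le_beta (hρ : Measurable ρ) {k : ℕ} {r : ℝ → ℝ≥0∞}
    (hr : Measurable r)
    (hle : ∀ᵐ t : ℝ, 0 < t →
      r t ≤ ‖sliceOp vol ρ G t ^ k - meanOp (levelUniform vol ρ t)‖ₑ) {x : X} (hx : ρ x ≠ 0) :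
    ∫⁻ t, r t ∂(levelKernel ρ hρ x) ≤ beta vol ρ G k := by
  have hhold := ENNReal.lintegral_mul_le_Lp_mul_Lq (levelKernel ρ hρ x)
    Real.HolderConjugate.two_two hr.aemeasurable (g := fun _ => 1) aemeasurable_const
  simp only [Pi.mul_apply, mul_one, ENNReal.one_rpow, lintegral_const,
    levelKernel_univ_eq_one hρ hx] at hhold
  refine hhold.trans ?_
  refine le_trans ?_ (le_iSup₂_of_le (f := fun (x : X) (_ : 0 < ρ x) =>
    ((ρ x : ℝ≥0∞)⁻¹ * ∫⁻ t in Icc (0 : ℝ) (ρ x),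
      ‖sliceOp vol ρ G t ^ k - meanOp (levelUniform vol ρ t)‖ₑ ^ 2) ^ (1 / 2 : ℝ))
      x (pos_iff_ne_zero.2 hx) le_rfl)
  refine ENNReal.rpow_le_rpow ?_ (by norm_num)
  rw [levelKernel_apply, lintegral_smul_measure, smul_eq_mul]
  refine mul_le_mul_right ?_ _
  refine lintegral_mono_ae ((ae_restrict_iff' measurableSet_Icc).2 ?_)
  filter_upwards [hle, Measure.ae_ne volume (0 : ℝ)] with t ht ht0 htI
  rw [ENNReal.rpow_two]
  gcongr
  exact ht (lt_of_le_of_ne htI.1 ht0.symm)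

variable [SFinite vol]

/-- A difference of two contractions has norm at most `2`, so every average in `beta` is bounded;
hence `toReal` loses nothing. -/
theorem beta_ne_top (hG : IsReversibleFamily vol ρ G)
    (hρ : Measurable ρ) (hfin : ∫⁻ x, (ρ x : ℝ≥0∞) ∂vol ≠ ∞) (k : ℕ) :
    beta vol ρ G k ≠ ∞ := by
  have hb : ∀ᵐ t ∂(levelLaw vol ρ),
      ‖sliceOp vol ρ G t ^ k - meanOp (levelUniform vol ρ t)‖ₑ ≤ 2 := by
    filter_upwards [hG, ae_isProbabilityMeasure_levelUniform hρ hfin] with t ht hprob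
    have h1 : ‖sliceOp vol ρ G t ^ k‖ ≤ 1 := by
      have hpow : ∀ n : ℕ, ‖sliceOp vol ρ G t ^ n‖ ≤ 1 := by
        intro n
        induction n with
        | zero => exact ContinuousLinearMap.norm_id_le
        | succ n ih =>
          rw [pow_succ]
          exact (norm_mul_le _ _).trans
            (mul_le_one₀ ih (norm_nonneg _) (norm_markovOp_le ht.1 ht.2))
      exact hpow k
    have h2 : ‖meanOp (levelUniform vol ρ t)‖ ≤ 1 :=
      norm_markovOp_le (ae_const_univ_eq_one _) (isReversible_const _)
    rw [← ofReal_norm]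
    refine (ENNReal.ofReal_le_ofReal ((norm_sub_le _ _).trans (add_le_add h1 h2))).trans ?_
    norm_num
  have hN : ∀ᵐ t : ℝ, 0 < t →
      ‖sliceOp vol ρ G t ^ k - meanOp (levelUniform vol ρ t)‖ₑ ≤ 2 := by
    filter_upwards [ae_volume_of_ae_levelLaw hρ hfin hb] with t ht ht0
    -- `ℓ` says nothing about such levels, but there `U_t = 0`, the space `L²(U_t)` is trivial and
    -- the norm is `0`.
    by_cases hv : vol (levelSet ρ t) = 0
    · have hU : levelUniform vol ρ t = 0 := by
        rw [levelUniform, Measure.restrict_eq_zero.2 hv, smul_zero]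
      have hT : sliceOp vol ρ G t ^ k - meanOp (levelUniform vol ρ t) = 0 := by
        ext1 g
        refine Lp.ext ?_
        have hbot : ae (levelUniform vol ρ t) = ⊥ := ae_eq_bot.2 hU
        rw [EventuallyEq, hbot]
        exact Filter.eventually_bot
      rw [← ofReal_norm, hT, norm_zero, ENNReal.ofReal_zero]
      exact zero_le
    · exact ht ht0 hv
  refine ne_top_of_le_ne_top (b := 2) (by norm_num) (iSup₂_le fun x hx => ?_)
  calc ((ρ x : ℝ≥0∞)⁻¹ * ∫⁻ t in Icc (0 : ℝ) (ρ x),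
        ‖sliceOp vol ρ G t ^ k - meanOp (levelUniform vol ρ t)‖ₑ ^ 2) ^ (1 / 2 : ℝ)
      ≤ ((ρ x : ℝ≥0∞)⁻¹ * ∫⁻ _ in Icc (0 : ℝ) (ρ x), 2 ^ 2) ^ (1 / 2 : ℝ) := by
        refine ENNReal.rpow_le_rpow (mul_le_mul_right ?_ _) (by norm_num)
        refine lintegral_mono_ae ((ae_restrict_iff' measurableSet_Icc).2 ?_)
        filter_upwards [hN, Measure.ae_ne volume (0 : ℝ)] with t ht ht0 htI
        gcongr
        exact ht (lt_of_le_of_ne htI.1 ht0.symm)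
    _ = (2 ^ 2 : ℝ≥0∞) ^ (1 / 2 : ℝ) := by
        rw [setLIntegral_const, Real.volume_Icc, sub_zero, ENNReal.ofReal_coe_nnreal, mul_comm,
          mul_assoc, ENNReal.mul_inv_cancel (by simpa using hx.ne') ENNReal.coe_ne_top, mul_one]
    _ = 2 := by
        rw [← ENNReal.rpow_natCast, ← ENNReal.rpow_mul]
        norm_num

variable [IsFiniteKernel G]

/-- The operator inequalities on a single level, read as inequalities between explicit integrals:
Bernoulli, positivity of the projection `U_t`, `U_t ≤ G_t^n`, and the operator-norm bound on `G_t^n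
- U_t`. -/
theorem ae_levelMoment_bounds (hG : IsReversibleFamily vol ρ G)
    (hρ : Measurable ρ) (hfin : ∫⁻ x, (ρ x : ℝ≥0∞) ∂vol ≠ ∞)
    (hpos : ∀ᵐ t ∂(levelLaw vol ρ), ∀ g : Lp ℝ 2 (levelUniform vol ρ t),
      0 ≤ inner ℝ (sliceOp vol ρ G t g) g)
    {f : X → ℝ} (hf : StronglyMeasurable f) (hL : MemLp f 2 (target vol ρ)) (n : ℕ) :
    ∀ᵐ t ∂(levelLaw vol ρ),
      levelMoment vol ρ G f 0 t - levelMoment vol ρ G f n t ≤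
        n * (levelMoment vol ρ G f 0 t - levelMoment vol ρ G f 1 t) ∧
      0 ≤ levelMoment vol ρ (uniformKernel vol ρ) f 1 t ∧
      levelMoment vol ρ (uniformKernel vol ρ) f 1 t ≤ levelMoment vol ρ G f n t ∧
      levelMoment vol ρ G f n t - levelMoment vol ρ (uniformKernel vol ρ) f 1 t ≤
        ‖sliceOp vol ρ G t ^ n - meanOp (levelUniform vol ρ t)‖ * levelMoment vol ρ G f 0 t := by
  filter_upwards [hG, hpos, ae_isProbabilityMeasure_levelUniform hρ hfin,
    ae_memLp_levelUniform (memLp_comp_snd hρ hfin hL),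
    ae_levelMoment_eq_inner hG hρ hfin hf hL 0, ae_levelMoment_eq_inner hG hρ hfin hf hL 1,
    ae_levelMoment_eq_inner hG hρ hfin hf hL n,
    ae_levelMoment_eq_inner (isReversibleFamily_uniformKernel hρ hfin) hρ hfin hf hL 1]
    with t htG htp hprob hft h0 h1 hn hu
  have hsym : (sliceOp vol ρ G t).IsSymmetric := isSymmetric_markovOp htG.1 htG.2
  have hM := isSymmetric_meanOp (levelUniform vol ρ t)
  have hMM := meanOp_mul_meanOp (levelUniform vol ρ t)
  have hAM : sliceOp vol ρ G t * meanOp (levelUniform vol ρ t) = meanOp (levelUniform vol ρ t) :=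
    markovOp_mul_meanOp htG.1 htG.2
  have hMA := mul_eq_of_isSymmetric hsym hM hAM
  set g := hft.toLp f
  rw [h0 hft, h1 hft, hn hft, hu hft, sliceOp_uniformKernel, pow_zero, pow_one, pow_one,
    one_apply_eq_self]
  refine ⟨bernoulli_inner_le hsym htp n g, ?_, ?_, ?_⟩
  · have h := hM (meanOp (levelUniform vol ρ t) g) g
    simp only [ContinuousLinearMap.coe_coe] at h
    rw [← mul_apply_eq_comp, hMM] at h
    rw [h]
    exact real_inner_self_nonneg
  · have h := inner_pow_sub_proj_nonneg hsym htp hM hMM hAM hMA n g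
    rw [sub_apply, inner_sub_left] at h
    linarith
  · have h := inner_apply_self_le (sliceOp vol ρ G t ^ n - meanOp (levelUniform vol ρ t)) g
    rwa [sub_apply, inner_sub_left, ← real_inner_self_eq_norm_sq] at h

theorem integral_levelMoment_sub_le (hG : IsReversibleFamily vol ρ G)
    (hρ : Measurable ρ) (hfin : ∫⁻ x, (ρ x : ℝ≥0∞) ∂vol ≠ ∞)
    (hpos : ∀ᵐ t ∂(levelLaw vol ρ), ∀ g : Lp ℝ 2 (levelUniform vol ρ t),
      0 ≤ inner ℝ (sliceOp vol ρ G t g) g)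
    {f : X → ℝ} (hf : StronglyMeasurable f) (hL : MemLp f 2 (target vol ρ)) {k : ℕ}
    (hβ : beta vol ρ G k ≠ ∞) :
    ∫ t, (levelMoment vol ρ G f k t - levelMoment vol ρ (uniformKernel vol ρ) f 1 t)
      ∂(levelLaw vol ρ) ≤ (beta vol ρ G k).toReal * ‖hL.toLp f‖ ^ 2 := by
  have hU := isReversibleFamily_uniformKernel (vol := vol) hρ hfin
  have hb := ae_levelMoment_bounds hG hρ hfin hpos hf hL k
  have hmk := stronglyMeasurable_levelMoment hG hρ hfin hf hL k
  have hm0 := stronglyMeasurable_levelMoment hG hρ hfin hf hL 0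
  have hmu := stronglyMeasurable_levelMoment hU hρ hfin hf hL 1
  set D : ℝ → ℝ := fun t =>
    levelMoment vol ρ G f k t - levelMoment vol ρ (uniformKernel vol ρ) f 1 t with hD
  have hDm : Measurable D := (hmk.sub hmu).measurable
  -- The quotient of the error by the second moment of `f` is measurable in `t` and lies below the
  -- operator norm, which makes it the required minorant.
  set r : ℝ → ℝ≥0∞ := fun t => ENNReal.ofReal (D t / levelMoment vol ρ G f 0 t) with hr_def
  have hr : Measurable r := (hDm.div hm0.measurable).ennreal_ofReal
  have hw : Measurable fun x => ENNReal.ofReal (f x * f x) :=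
    (hf.measurable.mul hf.measurable).ennreal_ofReal
  have hm0_nonneg : ∀ t, 0 ≤ levelMoment vol ρ G f 0 t := fun t =>
    integral_nonneg fun x => mul_self_nonneg (f x)
  have hD_nonneg : 0 ≤ᵐ[levelLaw vol ρ] D := hb.mono fun t ht => sub_nonneg.2 ht.2.2.1
  have hDint : Integrable D (levelLaw vol ρ) :=
    (integrable_levelMoment hG hρ hfin hf hL k).sub (integrable_levelMoment hU hρ hfin hf hL 1)
  have hrN : ∀ᵐ t : ℝ, 0 < t →
      r t ≤ ‖sliceOp vol ρ G t ^ k - meanOp (levelUniform vol ρ t)‖ₑ := by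
    filter_upwards [ae_volume_of_ae_levelLaw hρ hfin hb] with t ht ht0
    by_cases hv : vol (levelSet ρ t) = 0
    · have h0 : levelMoment vol ρ G f 0 t = 0 := by
        rw [levelMoment_zero_eq, levelUniform, Measure.restrict_eq_zero.2 hv, smul_zero,
          integral_zero_measure]
      simp [hr_def, h0]
    · rw [← ofReal_norm]
      exact ENNReal.ofReal_le_ofReal
        (div_le_of_le_mul₀ (hm0_nonneg t) (norm_nonneg _) (ht ht0 hv).2.2.2)
  have hDr : ∀ᵐ t ∂(levelLaw vol ρ), ENNReal.ofReal (D t) ≤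
      ∫⁻ x, r t * ENNReal.ofReal (f x * f x) ∂(levelUniform vol ρ t) := by
    filter_upwards [hb, ae_memLp_levelUniform (memLp_comp_snd hρ hfin hL)] with t ht hft
    have hsq : Integrable (fun x => f x * f x) (levelUniform vol ρ t) := hft.integrable_mul hft
    rw [lintegral_const_mul _ hw, ← ofReal_integral_eq_lintegral_ofReal hsq
      (Eventually.of_forall fun x => mul_self_nonneg (f x))]
    change _ ≤ r t * ENNReal.ofReal (levelMoment vol ρ G f 0 t)
    rw [hr_def, ← ENNReal.ofReal_mul' (hm0_nonneg t)]
    refine ENNReal.ofReal_le_ofReal ?_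
    -- When the second moment is zero the quotient is `0` by convention, but then the operator-norm
    -- bound already gives `D t ≤ 0`.
    rcases eq_or_ne (levelMoment vol ρ G f 0 t) 0 with h0 | h0
    · have := ht.2.2.2
      rw [h0, mul_zero] at this ⊢
      exact this
    · rw [div_mul_cancel₀ _ h0]
  have hmain : ENNReal.ofReal (∫ t, D t ∂(levelLaw vol ρ)) ≤
      beta vol ρ G k * ENNReal.ofReal (‖hL.toLp f‖ ^ 2) := by
    rw [ofReal_integral_eq_lintegral_ofReal hDint hD_nonneg]
    calc ∫⁻ t, ENNReal.ofReal (D t) ∂(levelLaw vol ρ)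
        ≤ ∫⁻ t, ∫⁻ x, r t * ENNReal.ofReal (f x * f x) ∂(levelUniform vol ρ t)
            ∂(levelLaw vol ρ) := lintegral_mono_ae hDr
      _ = ∫⁻ x, ∫⁻ t, r t * ENNReal.ofReal (f x * f x) ∂(levelKernel ρ hρ x)
            ∂(target vol ρ) :=
          (lintegral_jointLaw hρ hfin
            ((hr.comp measurable_fst).mul (hw.comp measurable_snd))).symm
      _ ≤ ∫⁻ x, beta vol ρ G k * ENNReal.ofReal (f x * f x) ∂(target vol ρ) := by
          refine lintegral_mono_ae ?_
          filter_upwards [ae_target_ne_zero vol hρ] with x hx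
          rw [lintegral_mul_const _ hr]
          gcongr
          exact lintegral_levelKernel_le_beta hρ hr hrN hx
      _ = beta vol ρ G k * ENNReal.ofReal (‖hL.toLp f‖ ^ 2) := by
          have hsq : Integrable (fun x => f x * f x) (target vol ρ) := hL.integrable_mul hL
          rw [lintegral_const_mul _ hw, ← ofReal_integral_eq_lintegral_ofReal hsq
            (Eventually.of_forall fun x => mul_self_nonneg (f x)),
            ← real_inner_self_eq_norm_sq, L2.inner_def]
          congr 2
          refine integral_congr_ae ?_
          filter_upwards [hL.coeFn_toLp] with x hx
          rw [hx]
          rfl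
  rw [← ENNReal.ofReal_toReal hβ, ← ENNReal.ofReal_mul ENNReal.toReal_nonneg] at hmain
  exact (ENNReal.ofReal_le_ofReal_iff (by positivity)).1 hmain

theorem gap_comparison (hG : IsReversibleFamily vol ρ G) (hρ : Measurable ρ)
    (h0 : ∫⁻ x, (ρ x : ℝ≥0∞) ∂vol ≠ 0) (hfin : ∫⁻ x, (ρ x : ℝ≥0∞) ∂vol ≠ ∞)
    (hpos : ∀ᵐ t ∂(levelLaw vol ρ), ∀ g : Lp ℝ 2 (levelUniform vol ρ t),
      0 ≤ inner ℝ (sliceOp vol ρ G t g) g) {k : ℕ} (hk : 1 ≤ k) :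
    (gap (simpleSliceSampler vol ρ hρ) (target vol ρ) - (beta vol ρ G k).toReal) / k
        ≤ gap (sliceSampler ρ hρ G) (target vol ρ) ∧
      gap (sliceSampler ρ hρ G) (target vol ρ)
        ≤ gap (simpleSliceSampler vol ρ hρ) (target vol ρ) := by
  have hprob := isProbabilityMeasure_target h0 hfin
  have hU := isReversibleFamily_uniformKernel (vol := vol) hρ hfin
  have hU1 := ae_sliceSampler_univ hρ hfin hU
  have hUr := isReversible_sliceSampler hρ hfin hU
  have hG1 := ae_sliceSampler_univ hρ hfin hG
  have hGr := isReversible_sliceSampler hρ hfin hG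
  have hM := isSymmetric_meanOp (target vol ρ)
  have hMM := meanOp_mul_meanOp (target vol ρ)
  -- Everything the norm comparison needs, as forms on `L²(π)`: `0 ≤ U ≤ H`, and the Bernoulli
  -- estimate with error `β_k`.
  have key : ∀ F : Lp ℝ 2 (target vol ρ),
      0 ≤ inner ℝ (markovOp (simpleSliceSampler vol ρ hρ) (target vol ρ) F) F ∧
      inner ℝ (markovOp (simpleSliceSampler vol ρ hρ) (target vol ρ) F) F ≤
        inner ℝ (markovOp (sliceSampler ρ hρ G) (target vol ρ) F) F ∧
      (1 - (beta vol ρ G k).toReal) * ‖F‖ ^ 2 -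
          inner ℝ (markovOp (simpleSliceSampler vol ρ hρ) (target vol ρ) F) F ≤
        k * (‖F‖ ^ 2 - inner ℝ (markovOp (sliceSampler ρ hρ G) (target vol ρ) F) F) := by
    intro F
    have hf := Lp.stronglyMeasurable F
    have hL := Lp.memLp F
    have hi0 := integrable_levelMoment hG hρ hfin hf hL 0
    have hi1 := integrable_levelMoment hG hρ hfin hf hL 1
    have hik := integrable_levelMoment hG hρ hfin hf hL k
    have hiu := integrable_levelMoment hU hρ hfin hf hL 1
    have hb1 := ae_levelMoment_bounds hG hρ hfin hpos hf hL 1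
    have hbk := ae_levelMoment_bounds hG hρ hfin hpos hf hL k
    have e0 := integral_levelMoment_zero hG hρ hfin hf hL
    have e1 := inner_sliceSampler_eq_integral hG hρ hfin hf hL
    have eu := inner_sliceSampler_eq_integral hU hρ hfin hf hL
    have hsub := integral_levelMoment_sub_le hG hρ hfin hpos hf hL (beta_ne_top hG hρ hfin k)
    have hbern := integral_mono_ae (hi0.sub hik) ((hi0.sub hi1).const_mul (k : ℝ))
      (hbk.mono fun t ht => ht.1)
    rw [Lp.toLp_coeFn] at e0 e1 eu hsub
    rw [integral_sub hik hiu] at hsub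
    rw [integral_const_mul, integral_sub' hi0 hik, integral_sub' hi0 hi1] at hbern
    rw [simpleSliceSampler, e1, eu, ← e0]
    rw [← e0] at hsub
    refine ⟨integral_nonneg_of_ae (hb1.mono fun t ht => ht.2.1),
      integral_mono_ae hiu hi1 (hb1.mono fun t ht => ht.2.2.1), ?_⟩
    linarith
  have hA := isSymmetric_markovOp hU1 hUr
  have hB := isSymmetric_markovOp hG1 hGr
  unfold gap
  constructor
  · exact div_le_one_sub_norm_sub_proj hB hM hMM (markovOp_mul_meanOp hG1 hGr)
      (meanOp_mul_markovOp hG1 hGr) (fun F => (key F).1.trans (key F).2.1)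
      ENNReal.toReal_nonneg hk fun F => (key F).2.2
  · exact sub_le_sub_left (norm_sub_proj_le_norm_sub_proj hA hM hMM
      (markovOp_mul_meanOp hU1 hUr) (meanOp_mul_markovOp hU1 hUr) (fun F => (key F).1)
      fun F => (key F).2.1) 1

end Comparison

/-! ### Irrelevance of the transition kernels outside their level sets. -/

section MarkovModification

variable {X : Type*} [MeasurableSpace X] {vol : Measure X} {ρ : X → ℝ≥0}

theorem markovOp_congr {κ κ' : Kernel X X} {μ : Measure X} (h : ∀ᵐ x ∂μ, κ x = κ' x) :
    markovOp κ μ = markovOp κ' μ := by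
  have he : ∀ f : X → ℝ, (fun x => ∫ y, f y ∂(κ x)) =ᵐ[μ] fun x => ∫ y, f y ∂(κ' x) :=
    fun f => h.mono fun x hx => by simp only [hx]
  by_cases hA : ∃ A, IsMarkovOperator κ μ A
  · obtain ⟨A, hA⟩ := hA
    have hA' : IsMarkovOperator κ' μ A := fun f hf => (hA f hf).trans (he f)
    rw [hA.markovOp_eq, hA'.markovOp_eq]
  · have hA' : ¬ ∃ A, IsMarkovOperator κ' μ A := fun ⟨A, hA'⟩ =>
      hA ⟨A, fun f hf => (hA' f hf).trans (he f).symm⟩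
    rw [markovOp, markovOp, dif_neg hA, dif_neg hA']

theorem isReversible_congr {κ κ' : Kernel X X} {μ : Measure X} (h : ∀ᵐ x ∂μ, κ x = κ' x)
    (hrev : κ.IsReversible μ) : κ'.IsReversible μ := by
  intro A B hA hB
  have he : ∀ A B : Set X, ∫⁻ x in A, κ' x B ∂μ = ∫⁻ x in A, κ x B ∂μ := fun A B =>
    lintegral_congr_ae (ae_restrict_of_ae (h.mono fun x hx => by simp only [hx]))
  rw [he A B, he B A]
  exact hrev hA hB

theorem measurableSet_posSubgraph (hρ : Measurable ρ) :
    MeasurableSet {p : X × ℝ | 0 < p.2 ∧ p.2 ≤ ρ p.1} :=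
  (measurableSet_lt measurable_const measurable_snd).inter
    (measurableSet_le measurable_snd (hρ.comp measurable_fst).coe_nnreal_real)

open Classical in
/-- The family `H`, made Markov by letting the chain rest where `x ∉ K(t)`. -/
noncomputable def markovModification (hρ : Measurable ρ) (H : Kernel (X × ℝ) X) :
    Kernel (X × ℝ) X :=
  Kernel.piecewise (measurableSet_posSubgraph hρ) H
    (Kernel.deterministic Prod.fst measurable_fst)

theorem markovModification_eq (hρ : Measurable ρ) (H : Kernel (X × ℝ) X) {x : X} {t : ℝ}
    (ht : 0 < t) (hx : t ≤ ρ x) : markovModification hρ H (x, t) = H (x, t) := by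
  rw [markovModification, Kernel.piecewise_apply, if_pos]
  exact ⟨ht, hx⟩

theorem isMarkovKernel_markovModification (hρ : Measurable ρ) {H : Kernel (X × ℝ) X}
    (hH : IsSliceFamily ρ H) : IsMarkovKernel (markovModification hρ H) := by
  refine ⟨fun p => ?_⟩
  rw [markovModification, Kernel.piecewise_apply]
  split_ifs with h
  · exact (hH p.2 h.1 p.1 h.2).1
  · infer_instance

/-- For fixed `x` the two families can differ on `[0, ρ(x)]` only at `t = 0`, a null set. -/
theorem sliceSampler_markovModification (hρ : Measurable ρ) (H : Kernel (X × ℝ) X) :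
    sliceSampler ρ hρ (markovModification hρ H) = sliceSampler ρ hρ H := by
  ext x A hA
  rw [sliceSampler_apply hρ _ x hA, sliceSampler_apply hρ _ x hA]
  congr 1
  refine lintegral_congr_ae ((ae_restrict_iff' measurableSet_Icc).2 ?_)
  filter_upwards [Measure.ae_ne volume (0 : ℝ)] with t ht0 htI
  rw [markovModification_eq hρ H (lt_of_le_of_ne htI.1 ht0.symm) htI.2]

theorem ae_mem_levelSet (vol : Measure X) (hρ : Measurable ρ) (t : ℝ) :
    ∀ᵐ x ∂(levelUniform vol ρ t), t ≤ ρ x :=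
  Measure.ae_smul_measure (ae_restrict_mem (measurableSet_levelSet hρ t)) _

theorem ae_sectL_markovModification (vol : Measure X) (hρ : Measurable ρ) (H : Kernel (X × ℝ) X)
    {t : ℝ} (ht : 0 < t) :
    ∀ᵐ x ∂(levelUniform vol ρ t), H.sectL t x = (markovModification hρ H).sectL t x :=
  (ae_mem_levelSet vol hρ t).mono fun _ hx => (markovModification_eq hρ H ht hx).symm

theorem sliceOp_markovModification (vol : Measure X) (hρ : Measurable ρ) (H : Kernel (X × ℝ) X)
    {t : ℝ} (ht : 0 < t) :
    sliceOp vol ρ (markovModification hρ H) t = sliceOp vol ρ H t :=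
  (markovOp_congr (ae_sectL_markovModification vol hρ H ht)).symm

theorem beta_markovModification (vol : Measure X) (hρ : Measurable ρ) (H : Kernel (X × ℝ) X)
    (k : ℕ) : beta vol ρ (markovModification hρ H) k = beta vol ρ H k := by
  refine iSup_congr fun x => iSup_congr fun _ => ?_
  congr 2
  refine lintegral_congr_ae ((ae_restrict_iff' measurableSet_Icc).2 ?_)
  filter_upwards [Measure.ae_ne volume (0 : ℝ)] with t ht0 htI
  rw [sliceOp_markovModification vol hρ H (lt_of_le_of_ne htI.1 ht0.symm)]

theorem isReversibleFamily_markovModification (hρ : Measurable ρ) {H : Kernel (X × ℝ) X}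
    (hH : IsSliceFamily ρ H)
    (hrev : ∀ᵐ t ∂(levelLaw vol ρ), (H.sectL t).IsReversible (levelUniform vol ρ t)) :
    IsReversibleFamily vol ρ (markovModification hρ H) := by
  have := isMarkovKernel_markovModification hρ hH
  filter_upwards [hrev, ae_levelLaw_of_forall (vol := vol) (ρ := ρ) (p := fun t => 0 < t)
    fun t ht _ => ht] with t htr ht0
  exact ⟨Eventually.of_forall fun x => measure_univ,
    isReversible_congr (ae_sectL_markovModification vol hρ H ht0) htr⟩

end MarkovModification

end SliceSampler

theorem mainTheorem1 {d : ℕ} {K : Set (EuclideanSpace ℝ (Fin d))} (hK : MeasurableSet K)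
    {ρ : K → ℝ≥0} (hρ : Measurable ρ)
    (hρ_pos : ∫⁻ x, (ρ x : ℝ≥0∞) ∂(SliceSampler.lebesgue K) ≠ 0)
    (hρ_fin : ∫⁻ x, (ρ x : ℝ≥0∞) ∂(SliceSampler.lebesgue K) ≠ ∞)
    (H : Kernel (K × ℝ) K) (hH : SliceSampler.IsSliceFamily ρ H)
    (hrev : ∀ᵐ t ∂(SliceSampler.levelLaw (SliceSampler.lebesgue K) ρ),
      (H.sectL t).IsReversible (SliceSampler.levelUniform (SliceSampler.lebesgue K) ρ t))
    (hpos : ∀ᵐ t ∂(SliceSampler.levelLaw (SliceSampler.lebesgue K) ρ),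
      ∀ f : Lp ℝ 2 (SliceSampler.levelUniform (SliceSampler.lebesgue K) ρ t),
        0 ≤ inner ℝ (SliceSampler.sliceOp (SliceSampler.lebesgue K) ρ H t f) f)
    (hβ : Tendsto (SliceSampler.beta (SliceSampler.lebesgue K) ρ H) atTop (𝓝 0))
    (k : ℕ) (hk : 1 ≤ k) :
    (SliceSampler.gap (SliceSampler.simpleSliceSampler (SliceSampler.lebesgue K) ρ hρ)
          (SliceSampler.target (SliceSampler.lebesgue K) ρ)
        - (SliceSampler.beta (SliceSampler.lebesgue K) ρ H k).toReal) / k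
      ≤ SliceSampler.gap (SliceSampler.sliceSampler ρ hρ H)
          (SliceSampler.target (SliceSampler.lebesgue K) ρ) ∧
    SliceSampler.gap (SliceSampler.sliceSampler ρ hρ H)
        (SliceSampler.target (SliceSampler.lebesgue K) ρ)
      ≤ SliceSampler.gap (SliceSampler.simpleSliceSampler (SliceSampler.lebesgue K) ρ hρ)
          (SliceSampler.target (SliceSampler.lebesgue K) ρ) := by
  -- Needed for Tonelli; as `K` is measurable, the image of its measure in the ambient space is a
  -- restriction of Lebesgue measure.
  have hσ : SigmaFinite (SliceSampler.lebesgue K) := by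
    refine SigmaFinite.of_map _ measurable_subtype_coe.aemeasurable ?_
    rw [SliceSampler.lebesgue, (MeasurableEmbedding.subtype_coe hK).map_comap]
    infer_instance
  -- `H` may be arbitrary off the level sets, even with unbounded mass; the comparison is run with
  -- the Markov version, which has the same sampler and the same `beta`.
  have := SliceSampler.isMarkovKernel_markovModification hρ hH
  have hpos' : ∀ᵐ t ∂(SliceSampler.levelLaw (SliceSampler.lebesgue K) ρ),
      ∀ f : Lp ℝ 2 (SliceSampler.levelUniform (SliceSampler.lebesgue K) ρ t),
        0 ≤ inner ℝ (SliceSampler.sliceOp (SliceSampler.lebesgue K) ρ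
          (SliceSampler.markovModification hρ H) t f) f := by
    filter_upwards [hpos, SliceSampler.ae_levelLaw_of_forall (vol := SliceSampler.lebesgue K)
      (ρ := ρ) (p := fun t => 0 < t) fun t ht _ => ht] with t htp ht0
    rwa [SliceSampler.sliceOp_markovModification _ hρ H ht0]
  have h := SliceSampler.gap_comparison
    (SliceSampler.isReversibleFamily_markovModification hρ hH hrev) hρ hρ_pos hρ_fin hpos' hk
  rwa [SliceSampler.beta_markovModification, SliceSampler.sliceSampler_markovModification] at h
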